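/- **Definitions.** A lattice simplex $\Delta\subset\mathbb R^d$ is the convex hull of $d+1$ affinely independent points $p_0,\dots,p_d\in\mathbb Z^d$; put $$\Lambda_\Delta=\Bigl\{(x_0,\dots,x_d)\in(\mathbb R/\mathbb Z)^{d+1}:\ \sum_{i=0}^d x_i\,(p_i,1)\in\mathbb Z^{d+1}\Bigr\}.$$ The $\delta$-polynomial of a $d$-dimensional lattice polytope $P\subset\mathbb R^d$ is $\delta(P,t)=(1-t)^{d+1}\bigl(1+\sum_{n\ge1}|nP\cap\mathbb Z^d|\,t^n\bigr)$. Two subsets $P,Q$ of $\mathbb R^d$ are unimodularly equivalent if $Q=PU+w$ for some $U\in\mathbb Z^{d\times d}$ with $\det U=\pm1$ and some $w\in\mathbb Z^d$. A lattice polytope $P\subset\mathbb R^d$ is reflexive if $0$ lies in its interior and $\{y:\langle x,y\rangle\le1\ \forall x\in P\}$ is a lattice polytope; it is Gorenstein if $rP$ is unimodularly equivalent to a reflexive polytope for some integer $r\ge1$. For integers $v\ge2$ and $k\ge0$ let $M(v,k)$ be the number, up to unimodular equivalence (over all dimensions $d$), of Gorenstein simplices $\Delta\subset\mathbb R^d$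 of dimension $d$ with $$\delta(\Delta,t)=1+t^{k+1}+t^{2(k+1)}+\cdots+t^{(v-1)(k+1)}$$ such that, for some ordering of the vertices, $\Lambda_\Delta$ is generated by a single element of the form $$\bigl(\underbrace{1/v_1,\dots,1/v_1}_{s_1},\underbrace{1/v_2,\dots,1/v_2}_{s_2},\dots,\underbrace{1/v_t,\dots,1/v_t}_{s_t}\bigr)\in(\mathbb R/\mathbb Z)^{d+1},$$ where $t\ge1$, $1<v_1<\cdots<v_t=v$ are integers with $v_i\mid v_{i+1}$ for $1\le i\le t-1$, and $s_1,\dots,s_t$ are positive integers. By convention, $M(1,k)=1$. For a positive integer $v$ let $D_v$ be the set of divisors of $v$ ordered by divisibility; a chain in $D_v$ is a totally ordered subset. **Corollary.** Let $v\ge2$ and $k\ge0$ be integers. Then $M(v,k)$ equals the number of chains in $D_v$ whose smallest element is not the least element $1$ of $D_v$ and whose largest element is $v$. Moreover, $$M(v,k)=\sum_{n\in D_v\setminus\{v\}}M(n,k).$$ -/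

import Mathlib

open scoped Pointwise

/-- An integer vector regarded as a point of `ℝ^d`. -/
def latticePoint {d : ℕ} (z : Fin d → ℤ) : Fin d → ℝ := fun i => (z i : ℝ)

/-- A lattice polytope in `ℝ^d`: the convex hull of finitely many integer points. -/
def IsLatticePolytope {d : ℕ} (P : Set (Fin d → ℝ)) : Prop :=
  ∃ V : Finset (Fin d → ℤ), P = convexHull ℝ (latticePoint '' (V : Set (Fin d → ℤ)))

/-- `P` is a `d`-dimensional lattice simplex in `ℝ^d` and `p 0, …, p d` is an ordering of its
vertices. -/
def IsVertexOrdering {d : ℕ} (P : Set (Fin d → ℝ)) (p : Fin (d + 1) → Fin d → ℤ) : Prop :=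
  AffineIndependent ℝ (fun i => latticePoint (p i)) ∧
    P = convexHull ℝ (Set.range fun i => latticePoint (p i))

/-- The finite abelian group `Λ_Δ ⊆ (ℝ/ℤ)^(d+1)` of the lattice simplex with (ordered) vertices
`p 0, …, p d`: all `(x_0, …, x_d)` such that `∑ x_i (p_i, 1)` lies in `ℤ^(d+1)`, i.e. such that
each of the `d + 1` coordinates of this sum vanishes in `ℝ/ℤ`. -/
def simplexGroup {d : ℕ} (p : Fin (d + 1) → Fin d → ℤ) :
    AddSubgroup (Fin (d + 1) → AddCircle (1 : ℝ)) where
  carrier := {x | (∀ j, ∑ i, p i j • x i = 0) ∧ ∑ i, x i = 0}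
  zero_mem' := by simp
  add_mem' := by
    rintro x y ⟨hx, hx'⟩ ⟨hy, hy'⟩
    refine ⟨fun j => ?_, ?_⟩
    · simp [Finset.sum_add_distrib, hx j, hy j]
    · simp [Finset.sum_add_distrib, hx', hy']
  neg_mem' := by
    rintro x ⟨hx, hx'⟩
    refine ⟨fun j => ?_, ?_⟩
    · simp [hx j]
    · simp [hx']

/-- The affine map `x ↦ x U + w` of `ℝ^d`. -/
def latticeAffineMap {d : ℕ} (U : Matrix (Fin d) (Fin d) ℤ) (w : Fin d → ℤ)
    (x : Fin d → ℝ) : Fin d → ℝ :=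
  Matrix.vecMul x (U.map (Int.castRingHom ℝ)) + latticePoint w

/-- Unimodular equivalence: `Q = P U + w` with an integer matrix `U` of determinant `±1` and an
integer vector `w`. -/
def UnimodularlyEquivalent {d : ℕ} (P Q : Set (Fin d → ℝ)) : Prop :=
  ∃ (U : Matrix (Fin d) (Fin d) ℤ) (w : Fin d → ℤ),
    (U.det = 1 ∨ U.det = -1) ∧ Q = latticeAffineMap U w '' P

theorem latticePoint_vecMul {d : ℕ} (U : Matrix (Fin d) (Fin d) ℤ) (w : Fin d → ℤ) :
    Matrix.vecMul (latticePoint w) (U.map (Int.castRingHom ℝ)) =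
      latticePoint (Matrix.vecMul w U) := by
  ext j
  simp [latticePoint, Matrix.vecMul, dotProduct]

theorem latticeAffineMap_comp {d : ℕ} (U V : Matrix (Fin d) (Fin d) ℤ) (w z : Fin d → ℤ)
    (x : Fin d → ℝ) :
    latticeAffineMap V z (latticeAffineMap U w x) =
      latticeAffineMap (U * V) (Matrix.vecMul w V + z) x := by
  unfold latticeAffineMap
  rw [Matrix.add_vecMul, Matrix.vecMul_vecMul, latticePoint_vecMul, Matrix.map_mul, add_assoc]
  congr 1
  ext j
  simp [latticePoint]

theorem latticeAffineMap_one_zero {d : ℕ} (x : Fin d → ℝ) : latticeAffineMap 1 0 x = x := by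
  ext j
  simp [latticeAffineMap, latticePoint]

theorem unimodularlyEquivalent_equivalence (d : ℕ) :
    Equivalence (UnimodularlyEquivalent (d := d)) where
  refl P := ⟨1, 0, by simp, by simp [latticeAffineMap_one_zero]⟩
  symm := by
    rintro P Q ⟨U, w, hU, rfl⟩
    have hunit : IsUnit U.det := by rcases hU with h | h <;> simp [h]
    refine ⟨U⁻¹, -Matrix.vecMul w U⁻¹, ?_, ?_⟩
    · have h1 : U.det * U⁻¹.det = 1 := by
        rw [← Matrix.det_mul, Matrix.mul_nonsing_inv U hunit, Matrix.det_one]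
      rcases hU with h | h
      · left
        rw [h] at h1
        linarith
      · right
        rw [h] at h1
        linarith
    · rw [Set.image_image]
      simp [latticeAffineMap_comp, Matrix.mul_nonsing_inv U hunit, latticeAffineMap_one_zero]
  trans := by
    rintro P Q R ⟨U, w, hU, rfl⟩ ⟨V, z, hV, rfl⟩
    refine ⟨U * V, Matrix.vecMul w V + z, ?_, ?_⟩
    · rw [Matrix.det_mul]
      rcases hU with h | h <;> rcases hV with h' | h' <;> simp [h, h']
    · rw [Set.image_image]
      simp [latticeAffineMap_comp]

/-- Unimodular equivalence as an equivalence relation on the subsets of `ℝ^d`. -/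
def unimodularSetoid (d : ℕ) : Setoid (Set (Fin d → ℝ)) :=
  ⟨UnimodularlyEquivalent, unimodularlyEquivalent_equivalence d⟩

/-- The Ehrhart series `1 + ∑_{n ≥ 1} |nP ∩ ℤ^d| t^n`. -/
noncomputable def ehrhartSeries {d : ℕ} (P : Set (Fin d → ℝ)) : PowerSeries ℤ :=
  PowerSeries.mk fun n =>
    if n = 0 then 1 else ((((n : ℝ) • P) ∩ Set.range latticePoint).ncard : ℤ)

/-- `f` is the `δ`-polynomial of the `d`-dimensional lattice polytope `P ⊆ ℝ^d`. -/
def IsDeltaPolynomial {d : ℕ} (P : Set (Fin d → ℝ)) (f : Polynomial ℤ) : Prop :=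
  (f : PowerSeries ℤ) = (1 - PowerSeries.X) ^ (d + 1) * ehrhartSeries P

/-- The dual `{y : ⟨x, y⟩ ≤ 1 for all x ∈ P}`. -/
def dualPolytope {d : ℕ} (P : Set (Fin d → ℝ)) : Set (Fin d → ℝ) :=
  {y | ∀ x ∈ P, x ⬝ᵥ y ≤ 1}

/-- A reflexive polytope in `ℝ^d` (it has dimension `d`, as its interior is nonempty). -/
def IsReflexive {d : ℕ} (P : Set (Fin d → ℝ)) : Prop :=
  IsLatticePolytope P ∧ 0 ∈ interior P ∧ IsLatticePolytope (dualPolytope P)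

/-- `P` is Gorenstein (of some index `r ≥ 1`): `rP` is unimodularly equivalent to a reflexive
polytope. -/
def IsGorenstein {d : ℕ} (P : Set (Fin d → ℝ)) : Prop :=
  ∃ r : ℕ, 0 < r ∧ ∃ Q : Set (Fin d → ℝ), IsReflexive Q ∧ UnimodularlyEquivalent ((r : ℝ) • P) Q

/-- `x = (1/v_1, …, 1/v_1, 1/v_2, …, 1/v_2, …, 1/v_t, …, 1/v_t) ∈ (ℝ/ℤ)^(d+1)` for some
`t ≥ 1` and integers `1 < v_1 < ⋯ < v_t = v` with `v_i ∣ v_(i+1)`, where each `1/v_i` is repeated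
`s_i ≥ 1` times. Here `t = m + 1`, `v_(i+1) = c i`, and `b j` is the block of the coordinate `j`;
`b` is monotone and onto, so the blocks are consecutive and nonempty. -/
def IsDivisorBlockVector (v : ℕ) {d : ℕ} (x : Fin (d + 1) → AddCircle (1 : ℝ)) : Prop :=
  ∃ (m : ℕ) (c : Fin (m + 1) → ℕ) (b : Fin (d + 1) → Fin (m + 1)),
    1 < c 0 ∧ StrictMono c ∧ (∀ i : Fin m, c i.castSucc ∣ c i.succ) ∧ c (Fin.last m) = v ∧
      Monotone b ∧ Function.Surjective b ∧
      ∀ j, x j = ((1 / (c (b j) : ℝ) : ℝ) : AddCircle (1 : ℝ))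

/-- The Gorenstein simplices counted by `M(v, k)`: lattice simplices `P` of dimension `d` whose
group `Λ_P` (for some ordering of the vertices) is generated by a vector as in
`IsDivisorBlockVector`, with `δ`-polynomial `1 + t^(k+1) + ⋯ + t^((v-1)(k+1))`. -/
def IsDivisorChainSimplex (v k : ℕ) {d : ℕ} (P : Set (Fin d → ℝ)) : Prop :=
  IsGorenstein P ∧
  (∃ p : Fin (d + 1) → Fin d → ℤ, IsVertexOrdering P p ∧
    ∃ x : Fin (d + 1) → AddCircle (1 : ℝ), IsDivisorBlockVector v x ∧
      simplexGroup p = AddSubgroup.zmultiples x) ∧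
  IsDeltaPolynomial P (∑ i ∈ Finset.range v, Polynomial.X ^ (i * (k + 1)))

/-- The unimodular equivalence classes, in all dimensions `d`, of the simplices of
`IsDivisorChainSimplex v k`. -/
def divisorChainClasses (v k : ℕ) : Set (Σ d : ℕ, Quotient (unimodularSetoid d)) :=
  {q | ∃ (d : ℕ) (P : Set (Fin d → ℝ)), IsDivisorChainSimplex v k P ∧
    q = ⟨d, Quotient.mk (unimodularSetoid d) P⟩}

/-- `M(v, k)`: the number of classes in `divisorChainClasses v k`, with the convention
`M(1, k) = 1` (for `v = 1` there is no sequence `1 < v_1 < ⋯ < v_t = v` with `t ≥ 1`). -/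
noncomputable def numDivisorChainSimplices (v k : ℕ) : ℕ :=
  if v = 1 then 1 else (divisorChainClasses v k).ncard

/-- The chains (totally ordered subsets) in the divisor lattice of `v` whose smallest element is
not the least element `1` of the lattice and whose largest element is `v`. -/
def divisorChains (v : ℕ) : Set (Finset ℕ) :=
  {C | C ⊆ v.divisors ∧ IsChain (· ∣ ·) (C : Set ℕ) ∧ v ∈ C ∧ ∃ a ∈ C, a ≠ 1 ∧ ∀ b ∈ C, a ∣ b}

/-!
The group `Λ_Δ` of a lattice simplex, up to a permutation of coordinates, determines the simplex up
to unimodular equivalence. If `Λ_Δ` is generated by `x = (1 / e 0, …, 1 / e d)`, then the `e i` are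
recovered from it, as the exponents of its coordinates, and they form a chain of divisors of `v` in
which `c` occurs `μ c` times. Now `Λ_Δ` consists of the multiples `a x` with `a < v`, and the
`δ`-polynomial is the sum of `t ^ height (a x)`, where `height (a x) = ∑ μ c {a / c}`. So the
condition on `δ` says that these heights are `0, k + 1, …, (v - 1) (k + 1)`.

Let `C ∪ {v}` be a chain, let `u` be the top of `C`, or `1` if `C` is empty, let `v = u g`, and
let `K` be the step of the progression of heights. Subadditivity of the height, which is strict
when there is a carry modulo `u`, shows that the height of `u x` is `K`, that is, `μ v = K g`.
Writing `a = u q + i`, the height of `a x` is then `q K` plus the height of `i` for the chain `C`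
in which `μ u` is increased by `K`, and these last heights have to form a progression with step
`K g`. By induction every chain carries exactly one `μ`. The simplex with these data is Gorenstein:
if `n` is the height of `x`, the lattice point with barycentric coordinates `1 / (n e i)` in the
`n`-th dilate has distance `1` from all facets. Hence the simplices correspond to the chains, and
removing the top from a chain gives the recursion.
-/

/-! ### Chains of divisors -/

/-- The chains of divisors with largest element `v` and without the element `1`, built from the
bottom: each new top `v` is put on a tower whose top `u` is a proper divisor of `v`. The empty
tower has the virtual top `1`, which lets one induction treat all tops alike. -/
inductive IsDivisorTower : ℕ → Finset ℕ → Prop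
  | one : IsDivisorTower 1 ∅
  | insert {u v : ℕ} {C : Finset ℕ} :
      IsDivisorTower u C → u ∈ v.properDivisors → IsDivisorTower v (insert v C)

namespace IsDivisorTower

variable {u v a b : ℕ} {C : Finset ℕ}

theorem pos (h : IsDivisorTower v C) : 0 < v := by
  cases h with
  | one => exact one_pos
  | insert _ huv => exact (Nat.zero_le _).trans_lt (Nat.mem_properDivisors.1 huv).2

theorem dvd_of_mem (h : IsDivisorTower v C) (ha : a ∈ C) : a ∣ v := by
  induction h with
  | one => simp at ha
  | insert _ huv ih =>
    rcases Finset.mem_insert.1 ha with rfl | ha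
    · rfl
    · exact (ih ha).trans (Nat.mem_properDivisors.1 huv).1

theorem le_of_mem (h : IsDivisorTower v C) (ha : a ∈ C) : a ≤ v :=
  Nat.le_of_dvd h.pos (h.dvd_of_mem ha)

theorem one_lt_of_mem (h : IsDivisorTower v C) (ha : a ∈ C) : 1 < a := by
  induction h with
  | one => simp at ha
  | insert hC huv ih =>
    rcases Finset.mem_insert.1 ha with rfl | ha
    · exact Nat.lt_of_le_of_lt hC.pos (Nat.mem_properDivisors.1 huv).2
    · exact ih ha

theorem top_mem (h : IsDivisorTower v C) (hv : v ≠ 1) : v ∈ C := by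
  cases h with
  | one => exact absurd rfl hv
  | insert => exact Finset.mem_insert_self _ _

theorem top_notMem (h : IsDivisorTower u C) (huv : u < v) : v ∉ C :=
  fun hv => huv.not_ge (h.le_of_mem hv)

theorem subset_divisors (h : IsDivisorTower v C) : C ⊆ v.divisors :=
  fun _ ha => Nat.mem_divisors.2 ⟨h.dvd_of_mem ha, h.pos.ne'⟩

theorem dvd_of_le (h : IsDivisorTower v C) (ha : a ∈ C) (hb : b ∈ C) (hab : a ≤ b) : a ∣ b := by
  induction h with
  | one => simp at ha
  | insert hC huv ih =>
    rcases Finset.mem_insert.1 hb with rfl | hbC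
    · exact (hC.insert huv).dvd_of_mem ha
    · rcases Finset.mem_insert.1 ha with rfl | ha
      · have hlt := (hC.le_of_mem hbC).trans_lt (Nat.mem_properDivisors.1 huv).2
        exact absurd hab hlt.not_ge
      · exact ih ha hbC

theorem isChain (h : IsDivisorTower v C) : IsChain (· ∣ ·) (C : Set ℕ) :=
  fun _ ha _ hb _ => (le_total _ _).imp (h.dvd_of_le ha hb) (h.dvd_of_le hb ha)

theorem top_unique (h : IsDivisorTower u C) (h' : IsDivisorTower v C) : u = v := by
  have dvd_top {x y : ℕ} (hx : IsDivisorTower x C) (hy : IsDivisorTower y C) : x ∣ y := by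
    by_cases hx1 : x = 1
    · exact hx1 ▸ one_dvd y
    · exact hy.dvd_of_mem (hx.top_mem hx1)
  exact Nat.dvd_antisymm (dvd_top h h') (dvd_top h' h)

theorem of_isChain (hdvd : ∀ a ∈ C, a ∣ v) (hC : IsChain (· ∣ ·) (C : Set ℕ)) (hv : v ∈ C)
    (hv0 : 0 < v) (h1 : 1 ∉ C) : IsDivisorTower v C := by
  induction v using Nat.strong_induction_on generalizing C with
  | _ v ih =>
    rw [← Finset.insert_erase hv]
    rcases (C.erase v).eq_empty_or_nonempty with hempty | hne
    · rw [hempty]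
      have hv1 : v ≠ 1 := fun h => h1 (h ▸ hv)
      exact one.insert (Nat.mem_properDivisors.2 ⟨one_dvd v, by omega⟩)
    · set u := (C.erase v).max' hne
      obtain ⟨huv, huC⟩ := Finset.mem_erase.1 ((C.erase v).max'_mem hne)
      have hu0 : 0 < u := Nat.pos_of_dvd_of_pos (hdvd u huC) hv0
      have hlt : u < v := (Nat.le_of_dvd hv0 (hdvd u huC)).lt_of_ne huv
      refine (ih u hlt (fun a ha => ?_) (hC.mono (by simp)) ((C.erase v).max'_mem hne) hu0
        (by simp [h1])).insert (Nat.mem_properDivisors.2 ⟨hdvd u huC, hlt⟩)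
      rcases eq_or_ne a u with rfl | hau
      · rfl
      · refine (hC (Finset.mem_of_mem_erase ha) huC hau).elim id fun hua => ?_
        have ha0 : 0 < a := Nat.pos_of_dvd_of_pos (hdvd a (Finset.mem_of_mem_erase ha)) hv0
        exact absurd (((C.erase v).le_max' a ha).antisymm (Nat.le_of_dvd ha0 hua)) hau

theorem mem_divisorChains (h : IsDivisorTower v C) (hv : v ≠ 1) : C ∈ divisorChains v := by
  have hne : C.Nonempty := ⟨v, h.top_mem hv⟩
  exact ⟨h.subset_divisors, h.isChain, h.top_mem hv, C.min' hne, C.min'_mem hne,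
    (h.one_lt_of_mem (C.min'_mem hne)).ne',
    fun b hb => h.dvd_of_le (C.min'_mem hne) hb (C.min'_le b hb)⟩

end IsDivisorTower

theorem divisorChains_eq_setOf_isDivisorTower {v : ℕ} (hv : v ≠ 1) :
    divisorChains v = {C | IsDivisorTower v C} := by
  refine Set.Subset.antisymm ?_ fun C hC => hC.mem_divisorChains hv
  rintro C ⟨hdiv, hchain, hvC, a, -, ha1, hmin⟩
  exact .of_isChain (fun b hb => Nat.dvd_of_mem_divisors (hdiv hb)) hchain hvC
    (Nat.pos_of_mem_divisors (hdiv hvC)) fun h1 => ha1 (Nat.dvd_one.1 (hmin 1 h1))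

theorem setOf_isDivisorTower_one : {C | IsDivisorTower 1 C} = {∅} := by
  ext C
  refine ⟨fun h => Finset.eq_empty_of_forall_notMem fun a ha => ?_, ?_⟩
  · exact (h.one_lt_of_mem ha).not_ge (h.le_of_mem ha)
  · rintro rfl
    exact .one

theorem setOf_isDivisorTower_eq_biUnion {v : ℕ} (hv : 1 < v) :
    {C | IsDivisorTower v C} =
      ⋃ u ∈ v.properDivisors, insert v '' {C | IsDivisorTower u C} := by
  ext C
  simp only [Set.mem_ofPred_eq, Set.mem_iUnion, Set.mem_image, exists_prop]
  refine ⟨fun h => ?_, ?_⟩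
  · cases h with
    | one => exact absurd hv (lt_irrefl 1)
    | insert hC huv => exact ⟨_, huv, _, hC, rfl⟩
  · rintro ⟨u, huv, C, hC, rfl⟩
    exact hC.insert huv

theorem ncard_isDivisorTower_eq_sum {v : ℕ} (hv : 1 < v) :
    {C | IsDivisorTower v C}.ncard =
      ∑ u ∈ v.properDivisors, {C | IsDivisorTower u C}.ncard := by
  have hfin (u : ℕ) : {C | IsDivisorTower u C}.Finite :=
    u.divisors.powerset.finite_toSet.subset fun C hC => by
      simpa using IsDivisorTower.subset_divisors hC
  have insert_inj {u u' : ℕ} {C C' : Finset ℕ} (hu : u < v) (hu' : u' < v)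
      (hC : IsDivisorTower u C) (hC' : IsDivisorTower u' C') (h : insert v C = insert v C') :
      C = C' := by
    rw [← Finset.erase_insert (hC.top_notMem hu), h, Finset.erase_insert (hC'.top_notMem hu')]
  have hlt {u : ℕ} (hu : u ∈ v.properDivisors) : u < v := (Nat.mem_properDivisors.1 hu).2
  have hdisj : (v.properDivisors : Set ℕ).PairwiseDisjoint
      fun u => insert v '' {C | IsDivisorTower u C} := by
    intro u hu u' hu' huu'
    refine Set.disjoint_left.2 ?_
    rintro _ ⟨C, hC, rfl⟩ ⟨C', hC', h⟩
    obtain rfl := insert_inj (hlt hu) (hlt hu') hC hC' h.symm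
    exact huu' (IsDivisorTower.top_unique hC hC')
  calc {C | IsDivisorTower v C}.ncard
      = ∑ᶠ u ∈ (v.properDivisors : Set ℕ), (insert v '' {C | IsDivisorTower u C}).ncard := by
        rw [setOf_isDivisorTower_eq_biUnion hv]
        exact Set.Finite.ncard_biUnion (Finset.finite_toSet _) (fun u _ => (hfin u).image _) hdisj
    _ = ∑ᶠ u ∈ (v.properDivisors : Set ℕ), {C | IsDivisorTower u C}.ncard :=
        finsum_mem_congr rfl fun u hu => Set.InjOn.ncard_image fun C hC C' hC' =>
          insert_inj (hlt hu) (hlt hu) hC hC'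
    _ = ∑ u ∈ v.properDivisors, {C | IsDivisorTower u C}.ncard := finsum_mem_coe_finset ..

/-! ### Weights with arithmetic heights -/

/-- `∑_{c ∈ C} μ c {a / c}`: the sum of the fractional parts of the entries of `a x`, if `x`
consists of `μ c` entries `1 / c` for each `c ∈ C`. -/
noncomputable def fractSum (C : Finset ℕ) (μ : ℕ → ℕ) (a : ℕ) : ℝ :=
  ∑ c ∈ C, μ c * ((a % c : ℕ) / c : ℝ)

section fractSum

variable {C : Finset ℕ} {μ ν : ℕ → ℕ} {u a b : ℕ}

theorem fractSum_congr (h : ∀ c ∈ C, μ c = ν c) (a : ℕ) : fractSum C μ a = fractSum C ν a :=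
  Finset.sum_congr rfl fun c hc => by rw [h c hc]

theorem fractSum_add_of_dvd (h : ∀ c ∈ C, c ∣ u) : fractSum C μ (u + a) = fractSum C μ a :=
  Finset.sum_congr rfl fun c hc => by
    rw [Nat.add_mod, Nat.mod_eq_zero_of_dvd (h c hc), zero_add, Nat.mod_mod]

theorem fractSum_zero : fractSum C μ 0 = 0 := by
  simp [fractSum]

theorem fractSum_nonneg : 0 ≤ fractSum C μ a :=
  Finset.sum_nonneg fun _ _ => by positivity

theorem fractSum_eq_zero_of_dvd (h : ∀ c ∈ C, c ∣ u) : fractSum C μ u = 0 := by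
  simpa [fractSum_zero] using fractSum_add_of_dvd (μ := μ) (a := 0) h

theorem fractSum_insert_of_lt {v : ℕ} (hv : v ∉ C) (ha : a < v) :
    fractSum (insert v C) μ a = μ v * (a / v) + fractSum C μ a := by
  rw [fractSum, Finset.sum_insert hv, Nat.mod_eq_of_lt ha, fractSum]

theorem fractSum_add_le : fractSum C μ (a + b) ≤ fractSum C μ a + fractSum C μ b := by
  rw [fractSum, fractSum, fractSum, ← Finset.sum_add_distrib]
  refine Finset.sum_le_sum fun c _ => ?_
  rw [← mul_add, ← add_div]
  gcongr
  exact_mod_cast (Nat.add_mod a b c).trans_le (Nat.mod_le _ _)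

theorem fractSum_add_lt (hu : u ∈ C) (hu0 : 0 < u) (hμ : 0 < μ u) (h : u ≤ a % u + b % u) :
    fractSum C μ (a + b) < fractSum C μ a + fractSum C μ b := by
  have hrest : fractSum (C.erase u) μ (a + b) ≤
      fractSum (C.erase u) μ a + fractSum (C.erase u) μ b := fractSum_add_le
  have hcarry : (((a + b) % u : ℕ) : ℝ) < (a % u : ℕ) + (b % u : ℕ) := by
    exact_mod_cast Nat.add_mod_add_of_le_add_mod h ▸ Nat.lt_add_of_pos_right hu0
  have hterm : (μ u : ℝ) * (((a + b) % u : ℕ) / u) <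
      μ u * ((a % u : ℕ) / u) + μ u * ((b % u : ℕ) / u) := by
    rw [← mul_add, ← add_div]
    gcongr
  have split (x : ℕ) : fractSum C μ x = μ u * ((x % u : ℕ) / u) + fractSum (C.erase u) μ x :=
    (Finset.add_sum_erase C _ hu).symm
  rw [split, split a, split b]
  linarith

theorem fractSum_update_add (hu : u ∈ C) (K a : ℕ) :
    fractSum C (Function.update μ u (μ u + K)) a = fractSum C μ a + K * ((a % u : ℕ) / u : ℝ) := by
  have hrest : fractSum (C.erase u) (Function.update μ u (μ u + K)) a = fractSum (C.erase u) μ a :=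
    fractSum_congr (fun c hc => Function.update_of_ne (Finset.ne_of_mem_erase hc) ..) a
  have split (ν : ℕ → ℕ) : fractSum C ν a = ν u * ((a % u : ℕ) / u) + fractSum (C.erase u) ν a :=
    (Finset.add_sum_erase C _ hu).symm
  rw [split, split μ, hrest, Function.update_self]
  push_cast
  ring

end fractSum

theorem fractSum_insert_mul {u g i q K : ℕ} {C : Finset ℕ} {μ : ℕ → ℕ}
    (hC : IsDivisorTower u C) (hug : u < u * g) (hμ : μ (u * g) = K * g)
    (hi : i < u) (hq : q < g) :
    fractSum (insert (u * g) C) μ (u * q + i) =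
      fractSum C (Function.update μ u (μ u + K)) i + (q * K : ℕ) := by
  have hu : (u : ℝ) ≠ 0 := mod_cast hC.pos.ne'
  have hg : (g : ℝ) ≠ 0 := mod_cast (Nat.zero_le q |>.trans_lt hq).ne'
  have hlt : u * q + i < u * g := by nlinarith
  have hlower : fractSum C μ (u * q + i) = fractSum C μ i :=
    fractSum_add_of_dvd fun c hc => (hC.dvd_of_mem hc).mul_right q
  have hupdate : fractSum C (Function.update μ u (μ u + K)) i = fractSum C μ i + K * (i / u) := by
    by_cases hu1 : u = 1
    · obtain rfl : i = 0 := by omega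
      simp [fractSum_zero]
    · rw [fractSum_update_add (hC.top_mem hu1), Nat.mod_eq_of_lt hi]
  have htop : (μ (u * g) : ℝ) * ((u * q + i : ℕ) / (u * g : ℕ)) = K * (i / u) + (q * K : ℕ) := by
    rw [hμ]
    push_cast
    field_simp
    ring
  rw [fractSum_insert_of_lt (hC.top_notMem hug) hlt, htop, hlower, hupdate]
  ring

section sumXPow

open Polynomial

theorem coeff_sum_X_pow_ne_zero_iff {α : Type*} {s : Finset α} {f : α → ℕ} {n : ℕ} :
    (∑ a ∈ s, (X : ℤ[X]) ^ f a).coeff n ≠ 0 ↔ n ∈ s.image f := by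
  simp only [finsetSum_coeff, coeff_X_pow, Finset.sum_boole, Nat.cast_ne_zero, Finset.card_ne_zero,
    Finset.filter_nonempty_iff, Finset.mem_image, eq_comm]

theorem image_eq_of_sum_X_pow_eq {α β : Type*} {s : Finset α} {t : Finset β} {f : α → ℕ}
    {g : β → ℕ} (h : ∑ a ∈ s, (X : ℤ[X]) ^ f a = ∑ b ∈ t, X ^ g b) : s.image f = t.image g := by
  ext n
  rw [← coeff_sum_X_pow_ne_zero_iff, h, coeff_sum_X_pow_ne_zero_iff]

theorem dvd_of_image_eq_image_mul {f : ℕ → ℕ} {n K a : ℕ}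
    (h : (Finset.range n).image f = (Finset.range n).image (· * K)) (ha : a < n) : K ∣ f a := by
  obtain ⟨i, -, hi⟩ := Finset.mem_image.1 (h ▸ Finset.mem_image_of_mem f (Finset.mem_range.2 ha))
  exact ⟨i, by rw [← hi, mul_comm]⟩

theorem exists_eq_mul_of_image_eq_image_mul {f : ℕ → ℕ} {n K i : ℕ}
    (h : (Finset.range n).image f = (Finset.range n).image (· * K)) (hi : i < n) :
    ∃ a < n, f a = i * K := by
  obtain ⟨a, ha, hfa⟩ := Finset.mem_image.1
    (h.symm ▸ Finset.mem_image_of_mem (· * K) (Finset.mem_range.2 hi))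
  exact ⟨a, Finset.mem_range.1 ha, hfa⟩

theorem injOn_of_image_eq_image_mul {f : ℕ → ℕ} {n K : ℕ} (hK : 0 < K)
    (h : (Finset.range n).image f = (Finset.range n).image (· * K)) :
    Set.InjOn f (Finset.range n) := by
  have hmul : Function.Injective (· * K) := mul_left_injective₀ hK.ne'
  rw [← Finset.card_image_iff, h, Finset.card_image_of_injective _ hmul]

theorem sum_range_mul_eq_sum_sum {M : Type*} [AddCommMonoid M] (F : ℕ → M) (u g : ℕ) :
    ∑ a ∈ Finset.range (u * g), F a =
      ∑ q ∈ Finset.range g, ∑ i ∈ Finset.range u, F (u * q + i) := by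
  induction g with
  | zero => simp
  | succ g ih => rw [Nat.mul_succ, Finset.sum_range_add, ih, Finset.sum_range_succ]

theorem sum_X_pow_mul_eq_iff {f : ℕ → ℕ} {u g K : ℕ} (hg : 0 < g) (F : ℕ → ℕ)
    (hF : ∀ q < g, ∀ i < u, F (u * q + i) = f i + q * K) :
    ∑ a ∈ Finset.range (u * g), (X : ℤ[X]) ^ F a = ∑ i ∈ Finset.range (u * g), X ^ (i * K) ↔
      ∑ a ∈ Finset.range u, (X : ℤ[X]) ^ f a = ∑ i ∈ Finset.range u, X ^ (i * (K * g)) := by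
  have hne : ∑ q ∈ Finset.range g, (X : ℤ[X]) ^ (q * K) ≠ 0 := fun h => by
    simpa [eval_finsetSum, hg.ne'] using congrArg (eval 1) h
  have hleft : ∑ a ∈ Finset.range (u * g), (X : ℤ[X]) ^ F a =
      (∑ q ∈ Finset.range g, X ^ (q * K)) * ∑ i ∈ Finset.range u, X ^ f i := by
    rw [sum_range_mul_eq_sum_sum, Finset.sum_mul_sum]
    refine Finset.sum_congr rfl fun q hq => Finset.sum_congr rfl fun i hi => ?_
    rw [hF q (Finset.mem_range.1 hq) i (Finset.mem_range.1 hi), pow_add, mul_comm]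
  have hright : ∑ i ∈ Finset.range (u * g), (X : ℤ[X]) ^ (i * K) =
      (∑ q ∈ Finset.range g, X ^ (q * K)) * ∑ i ∈ Finset.range u, X ^ (i * (K * g)) := by
    rw [mul_comm u, sum_range_mul_eq_sum_sum, Finset.sum_mul_sum, Finset.sum_comm]
    refine Finset.sum_congr rfl fun q _ => Finset.sum_congr rfl fun i _ => ?_
    rw [← pow_add]
    ring
  rw [hleft, hright, mul_right_inj' hne]

end sumXPow

theorem eq_mul_of_subadditive {f : ℕ → ℕ} {v K a : ℕ} (hK : 0 < K) (ha : 0 < a) (h0 : f 0 = 0)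
    (hadd : ∀ b, b + a < v → f (b + a) ≤ f b + f a) (hdvd : ∀ b < v, K ∣ f b)
    (hinj : Set.InjOn f (Finset.range v)) (hfa : f a = K) (i : ℕ) (hi : i * a < v) :
    f (i * a) = i * K := by
  induction i using Nat.strong_induction_on with
  | _ i ih =>
    cases i with
    | zero => simp [h0]
    | succ i =>
      have hia : i * a + a < v := by rwa [← Nat.succ_mul]
      have hprev : f (i * a) = i * K := ih i i.lt_succ_self (by omega)
      obtain ⟨j, hj⟩ := hdvd _ hi
      have hle : j ≤ i + 1 := by
        have := hadd (i * a) hia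
        rw [← Nat.succ_mul, hj, hprev, hfa] at this
        exact Nat.le_of_mul_le_mul_left (by linarith) hK
      rcases hle.eq_or_lt with rfl | hlt
      · rw [hj, mul_comm]
      · have hja : j * a < v := (Nat.mul_lt_mul_of_pos_right hlt ha).trans hi
        have heq : f (j * a) = f ((i + 1) * a) := by rw [ih j hlt hja, hj, mul_comm]
        have := hinj (by simpa using hja) (by simpa using hi) heq
        exact absurd (Nat.eq_of_mul_eq_mul_right ha this) hlt.ne

open Polynomial in
/-- The heights `fractSum C μ a`, `0 ≤ a < v`, are the numbers `0, K, 2 K, …, (v - 1) K`, each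
attained once; the second condition says this through the generating polynomial, as the
`δ`-polynomial does. -/
def HasArithmeticHeights (C : Finset ℕ) (v K : ℕ) (μ : ℕ → ℕ) : Prop :=
  ∃ f : ℕ → ℕ, (∀ a < v, (f a : ℝ) = fractSum C μ a) ∧
    ∑ a ∈ Finset.range v, (X : ℤ[X]) ^ f a = ∑ i ∈ Finset.range v, X ^ (i * K)

theorem HasArithmeticHeights.congr {C : Finset ℕ} {v K : ℕ} {μ ν : ℕ → ℕ}
    (h : HasArithmeticHeights C v K μ) (hμν : ∀ c ∈ C, μ c = ν c) :
    HasArithmeticHeights C v K ν := by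
  obtain ⟨f, hf, hsum⟩ := h
  exact ⟨f, fun a ha => (hf a ha).trans (fractSum_congr hμν a), hsum⟩

section tower

variable {C : Finset ℕ} {u v g K : ℕ} {μ ν : ℕ → ℕ}

theorem hasArithmeticHeights_insert_iff (hC : IsDivisorTower u C) (hug : u < u * g)
    (hμ : μ (u * g) = K * g) :
    HasArithmeticHeights (insert (u * g) C) (u * g) K μ ↔
      HasArithmeticHeights C u (K * g) (Function.update μ u (μ u + K)) := by
  have hg : 0 < g := Nat.pos_of_ne_zero fun h => by simp [h] at hug
  have hcast {i q : ℕ} (hi : i < u) (hq : q < g) :=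
    fractSum_insert_mul (K := K) hC hug hμ hi hq
  have hlt {i q : ℕ} (hi : i < u) (hq : q < g) : u * q + i < u * g := by nlinarith
  have hcast0 {i : ℕ} (hi : i < u) := by simpa using hcast hi hg
  constructor
  · rintro ⟨f, hf, hsum⟩
    refine ⟨f, fun i hi => (hf i (hi.trans hug)).trans (hcast0 hi),
      (sum_X_pow_mul_eq_iff hg f fun q hq i hi => ?_).1 hsum⟩
    have : (f (u * q + i) : ℝ) = f i + (q * K : ℕ) := by
      rw [hf _ (hlt hi hq), hf i (hi.trans hug), hcast hi hq, hcast0 hi]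
    exact_mod_cast this
  · rintro ⟨f, hf, hsum⟩
    refine ⟨fun a => f (a % u) + a / u * K, fun a ha => ?_,
      (sum_X_pow_mul_eq_iff hg _ fun q _ i hi => ?_).2 hsum⟩
    · have hq : a / u < g := Nat.div_lt_of_lt_mul ha
      have hi : a % u < u := Nat.mod_lt a hC.pos
      rw [← Nat.div_add_mod a u, hcast hi hq, ← hf _ hi, Nat.div_add_mod, Nat.cast_add]
    · rw [Nat.mul_add_mod, Nat.mod_eq_of_lt hi, Nat.mul_add_div hC.pos, Nat.div_eq_of_lt hi,
        add_zero]

theorem height_zero {f : ℕ → ℕ} (hv : 0 < v) (hf : ∀ a < v, (f a : ℝ) = fractSum C μ a) :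
    f 0 = 0 := by
  have h0 : (f 0 : ℝ) = 0 := by rw [hf 0 hv, fractSum_zero]
  exact_mod_cast h0

theorem le_of_height_eq {f : ℕ → ℕ} {a : ℕ} (hK : 0 < K) (hu : u ∈ C) (hμ : 0 < μ u)
    (huv : 2 * u ≤ v) (hf : ∀ a < v, (f a : ℝ) = fractSum C μ a) (hdvd : ∀ a < v, K ∣ f a)
    (hinj : Set.InjOn f (Finset.range v)) (ha : 0 < a) (hfa : f a = K) : u ≤ a := by
  by_contra! hau
  have f_zero : f 0 = 0 := height_zero (by omega) hf
  have f_add_le (b : ℕ) (hb : b + a < v) : f (b + a) ≤ f b + f a := by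
    have hle : (f (b + a) : ℝ) ≤ f b + f a := by
      rw [hf _ hb, hf b (by omega), hf a (by omega)]
      exact fractSum_add_le
    exact_mod_cast hle
  have f_mul := eq_mul_of_subadditive hK ha f_zero f_add_le hdvd hinj hfa
  -- The last multiple `i a` of `a` below `u`: passing to `(i + 1) a` carries at `u`.
  set i := (u - 1) / a
  have hlow : i * a ≤ u - 1 := Nat.div_mul_le_self _ _
  have hhigh : u - 1 < i * a + a := Nat.lt_div_mul_add ha
  have hlt : (f (i * a + a) : ℝ) < f (i * a) + f a := by
    rw [hf _ (by omega), hf _ (by omega), hf a (by omega)]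
    refine fractSum_add_lt hu (by omega) hμ ?_
    rw [Nat.mod_eq_of_lt (by omega), Nat.mod_eq_of_lt hau]
    omega
  have hsucc : f (i * a + a) = (i + 1) * K := by
    rw [← Nat.succ_mul]
    exact f_mul _ (by rw [Nat.succ_mul]; omega)
  rw [hsucc, f_mul i (by omega), hfa] at hlt
  push_cast at hlt
  linarith

theorem HasArithmeticHeights.top_weight_eq (hC : IsDivisorTower u C) (hug : u < u * g)
    (hK : 0 < K) (hμ : ∀ c ∈ C, 0 < μ c)
    (h : HasArithmeticHeights (insert (u * g) C) (u * g) K μ) : μ (u * g) = K * g := by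
  obtain ⟨f, hf, hsum⟩ := h
  have himage := image_eq_of_sum_X_pow_eq hsum
  have hinj : Set.InjOn f (Finset.range (u * g)) := injOn_of_image_eq_image_mul hK himage
  have hdvd (a : ℕ) (ha : a < u * g) : K ∣ f a := dvd_of_image_eq_image_mul himage ha
  have hu := hC.pos
  have hg : 2 ≤ g := by by_contra! hg; nlinarith
  have hf' {b : ℕ} (hb : b < u * g) :
      (f b : ℝ) = μ (u * g) * (b / (u * g : ℕ)) + fractSum C μ b := by
    rw [hf b hb, fractSum_insert_of_lt (hC.top_notMem hug) hb]
  have f_zero : f 0 = 0 := height_zero (by omega) hf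
  have f_u : (f u : ℝ) = μ (u * g) * (u / (u * g : ℕ)) := by
    rw [hf' hug, fractSum_eq_zero_of_dvd fun c hc => hC.dvd_of_mem hc, add_zero]
  obtain ⟨a, ha, hfa⟩ := exists_eq_mul_of_image_eq_image_mul himage (i := 1) (by omega)
  rw [one_mul] at hfa
  have hua : u ≤ a := by
    have ha0 : 0 < a := Nat.pos_of_ne_zero fun h0 => hK.ne (by rw [← hfa, h0, f_zero])
    by_cases hu1 : u = 1
    · omega
    · have huC : u ∈ C := hC.top_mem hu1
      exact le_of_height_eq hK (Finset.mem_insert_of_mem huC) (hμ u huC) (by nlinarith) hf hdvd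
        hinj ha0 hfa
  have hle : f u ≤ K := by
    have : (f u : ℝ) ≤ f a := by
      rw [f_u, hf' ha]
      refine le_add_of_le_of_nonneg ?_ fractSum_nonneg
      gcongr
    exact hfa ▸ (by exact_mod_cast this)
  have hne : f u ≠ 0 := fun h0 =>
    hu.ne' (hinj (by simpa using hug) (by simp; omega) (h0.trans f_zero.symm))
  rw [hle.antisymm (Nat.le_of_dvd (Nat.pos_of_ne_zero hne) (hdvd u hug))] at f_u
  have hu' : (u : ℝ) ≠ 0 := mod_cast hu.ne'
  have hg' : (g : ℝ) ≠ 0 := mod_cast (by omega)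
  push_cast at f_u
  field_simp at f_u
  exact_mod_cast f_u.symm

theorem HasArithmeticHeights.unique (hC : IsDivisorTower v C) (hK : 0 < K)
    (hμ : ∀ c ∈ C, 0 < μ c) (hν : ∀ c ∈ C, 0 < ν c) (h : HasArithmeticHeights C v K μ)
    (h' : HasArithmeticHeights C v K ν) : ∀ c ∈ C, μ c = ν c := by
  induction hC generalizing K μ ν with
  | one => simp
  | @insert u v C hC huv ih =>
    obtain ⟨⟨g, rfl⟩, hug⟩ := Nat.mem_properDivisors.1 huv
    simp only [Finset.forall_mem_insert] at hμ hν ⊢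
    have htop := h.top_weight_eq hC hug hK hμ.2
    have htop' := h'.top_weight_eq hC hug hK hν.2
    have hKg : 0 < K * g := htop ▸ hμ.1
    have hpos {ξ : ℕ → ℕ} (hξ : ∀ c ∈ C, 0 < ξ c) :
        ∀ c ∈ C, 0 < Function.update ξ u (ξ u + K) c := fun c hc => by
      rcases eq_or_ne c u with rfl | hcu
      · simp [hK]
      · simpa [hcu] using hξ c hc
    refine ⟨htop.trans htop'.symm, fun c hc => ?_⟩
    have := ih hKg (hpos hμ.2) (hpos hν.2) ((hasArithmeticHeights_insert_iff hC hug htop).1 h)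
      ((hasArithmeticHeights_insert_iff hC hug htop').1 h') c hc
    rcases eq_or_ne c u with rfl | hcu
    · simpa using this
    · simpa [hcu] using this

theorem exists_hasArithmeticHeights (hC : IsDivisorTower v C) (hK : 0 < K) :
    ∃ μ : ℕ → ℕ, (∀ c ∈ C, 0 < μ c) ∧ HasArithmeticHeights C v K μ := by
  -- The stronger bound at the top leaves a positive weight after the subtraction of `K` below.
  suffices ∃ μ : ℕ → ℕ, (∀ c ∈ C, 0 < μ c) ∧ (v ∈ C → K < μ v) ∧ HasArithmeticHeights C v K μ by
    obtain ⟨μ, hpos, -, hμ⟩ := this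
    exact ⟨μ, hpos, hμ⟩
  induction hC generalizing K with
  | one => exact ⟨0, by simp, by simp, 0, by simp [fractSum], by simp⟩
  | @insert u v C hC huv ih =>
    obtain ⟨⟨g, rfl⟩, hug⟩ := Nat.mem_properDivisors.1 huv
    have hg : 2 ≤ g := by by_contra! hg; nlinarith
    obtain ⟨ν, hpos, htop, hν⟩ := ih (K := K * g) (by positivity)
    have hKg : K < K * g := by nlinarith
    set μ := Function.update (Function.update ν u (ν u - K)) (u * g) (K * g)
    have hμ_top : μ (u * g) = K * g := Function.update_self ..
    have hμ_u : μ u = ν u - K := by simp [μ, hug.ne]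
    have hμ_lower {c : ℕ} (hc : c ∈ C) (hcu : c ≠ u) : μ c = ν c := by
      simp [μ, hcu, ((hC.le_of_mem hc).trans_lt hug).ne]
    have hμν : ∀ c ∈ C, ν c = Function.update μ u (μ u + K) c := fun c hc => by
      rcases eq_or_ne c u with rfl | hcu
      · have := htop hc
        rw [Function.update_self, hμ_u]
        omega
      · rw [Function.update_of_ne hcu, hμ_lower hc hcu]
    refine ⟨μ, ?_, fun _ => by rwa [hμ_top],
      (hasArithmeticHeights_insert_iff hC hug hμ_top).2 (hν.congr hμν)⟩
    refine Finset.forall_mem_insert _ _ _ |>.2 ⟨by rw [hμ_top]; omega, fun c hc => ?_⟩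
    rcases eq_or_ne c u with rfl | hcu
    · have := htop hc
      omega
    · exact hμ_lower hc hcu ▸ hpos c hc

end tower

/-! ### The Ehrhart series of a lattice simplex -/

theorem latticePoint_injective {d : ℕ} : Function.Injective (latticePoint (d := d)) :=
  fun _ _ h => funext fun i => Int.cast_injective (congrFun h i)

/-- The representative in `[0, 1)` of an element of `ℝ/ℤ`. -/
noncomputable def circleFract (y : AddCircle (1 : ℝ)) : ℝ := AddCircle.equivIco 1 0 y

theorem circleFract_coe (r : ℝ) : circleFract (r : AddCircle (1 : ℝ)) = Int.fract r := by
  rw [circleFract, AddCircle.coe_equivIco_mk_apply, div_one, mul_one]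

theorem coe_circleFract (y : AddCircle (1 : ℝ)) : (circleFract y : AddCircle (1 : ℝ)) = y :=
  AddCircle.coe_equivIco

theorem circleFract_nonneg (y : AddCircle (1 : ℝ)) : 0 ≤ circleFract y :=
  (AddCircle.equivIco 1 0 y).2.1

theorem circleFract_lt_one (y : AddCircle (1 : ℝ)) : circleFract y < 1 :=
  (AddCircle.equivIco 1 0 y).2.2.trans_eq (zero_add 1)

theorem coe_circleFract_add_natCast (y : AddCircle (1 : ℝ)) (a : ℕ) :
    ((circleFract y + a : ℝ) : AddCircle (1 : ℝ)) = y := by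
  rw [AddCircle.coe_add, coe_circleFract, add_eq_left, AddCircle.coe_eq_zero_iff]
  exact ⟨a, by simp⟩

theorem floor_circleFract_add_natCast (y : AddCircle (1 : ℝ)) (a : ℕ) :
    ⌊circleFract y + a⌋₊ = a := by
  rw [Nat.floor_add_natCast (circleFract_nonneg y), Nat.floor_eq_zero.2 (circleFract_lt_one y),
    zero_add]

theorem circleFract_coe_add_floor {r : ℝ} (hr : 0 ≤ r) :
    circleFract (r : AddCircle (1 : ℝ)) + ⌊r⌋₊ = r := by
  rw [circleFract_coe, natCast_floor_eq_intCast_floor hr, Int.fract_add_floor]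

theorem coe_sum_addCircle {ι : Type*} (s : Finset ι) (f : ι → ℝ) :
    ((∑ i ∈ s, f i : ℝ) : AddCircle (1 : ℝ)) = ∑ i ∈ s, (f i : AddCircle (1 : ℝ)) :=
  map_sum (QuotientAddGroup.mk' _) f s

theorem coe_addCircle_eq_zero_iff (r : ℝ) :
    (r : AddCircle (1 : ℝ)) = 0 ↔ r ∈ Set.range ((↑) : ℤ → ℝ) := by
  rw [AddCircle.coe_eq_zero_iff]
  simp

/-- The height `∑ x_i` of an element of `Λ_Δ`, with representatives `x_i` in `[0, 1)`. On `Λ_Δ`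
this sum is an integer, see `cast_groupHeight`; elsewhere it is rounded down. -/
noncomputable def groupHeight {ι : Type*} [Fintype ι] (y : ι → AddCircle (1 : ℝ)) : ℕ :=
  ⌊∑ i, circleFract (y i)⌋₊

theorem cast_groupHeight {ι : Type*} [Fintype ι] {y : ι → AddCircle (1 : ℝ)}
    (hy : ∑ i, y i = 0) : (groupHeight y : ℝ) = ∑ i, circleFract (y i) := by
  have hcoe : ((∑ i, circleFract (y i) : ℝ) : AddCircle (1 : ℝ)) = 0 := by
    simpa only [coe_sum_addCircle, coe_circleFract] using hy
  obtain ⟨n, hn⟩ := (coe_addCircle_eq_zero_iff _).1 hcoe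
  have h0 : 0 ≤ ∑ i, circleFract (y i) := Finset.sum_nonneg fun i _ => circleFract_nonneg _
  rw [groupHeight, ← hn]
  rw [← hn] at h0
  lift n to ℕ using Int.cast_nonneg_iff.1 h0
  simp

theorem mem_smul_convexHull_range_iff {ι E : Type*} [Fintype ι] [Nonempty ι] [AddCommGroup E]
    [Module ℝ E] (p : ι → E) {r : ℝ} (hr : 0 ≤ r) (y : E) :
    y ∈ r • convexHull ℝ (Set.range p) ↔
      ∃ μ : ι → ℝ, (∀ i, 0 ≤ μ i) ∧ ∑ i, μ i = r ∧ ∑ i, μ i • p i = y := by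
  constructor
  · rintro ⟨_, hx, rfl⟩
    rw [convexHull_range_eq_exists_affineCombination] at hx
    obtain ⟨s, μ, hμ, hsum, rfl⟩ := hx
    classical
    refine ⟨fun i => if i ∈ s then r * μ i else 0, fun i => ?_, ?_, ?_⟩
    · dsimp only
      split_ifs with hi
      exacts [mul_nonneg hr (hμ i hi), le_rfl]
    · rw [Finset.sum_ite_mem, Finset.univ_inter, ← Finset.mul_sum, hsum, mul_one]
    · simp only [ite_smul, zero_smul, mul_smul]
      rw [Finset.sum_ite_mem, Finset.univ_inter, ← Finset.smul_sum,
        s.affineCombination_eq_linear_combination _ _ hsum]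
  · rintro ⟨μ, hμ, hsum, rfl⟩
    rcases hr.eq_or_lt with rfl | hpos
    · have h0 : ∀ i, μ i = 0 := fun i =>
        (Finset.sum_eq_zero_iff_of_nonneg fun i _ => hμ i).1 hsum i (Finset.mem_univ i)
      simp [h0, Set.zero_smul_set (Set.range_nonempty p).convexHull]
    · rw [Set.mem_smul_set_iff_inv_smul_mem₀ hpos.ne', Finset.smul_sum]
      simp_rw [← mul_smul]
      refine (convex_convexHull ℝ _).sum_mem (fun i _ => mul_nonneg (by positivity) (hμ i)) ?_
        fun i _ => subset_convexHull ℝ _ ⟨i, rfl⟩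
      rw [← Finset.mul_sum, hsum, inv_mul_cancel₀ hpos.ne']

theorem coe_mem_simplexGroup_iff {d : ℕ} (p : Fin (d + 1) → Fin d → ℤ) (μ : Fin (d + 1) → ℝ) :
    (fun i => (μ i : AddCircle (1 : ℝ))) ∈ simplexGroup p ↔
      ∑ i, μ i • latticePoint (p i) ∈ Set.range (latticePoint (d := d)) ∧
        ∑ i, μ i ∈ Set.range ((↑) : ℤ → ℝ) := by
  have hcoord (j : Fin d) : ∑ i, p i j • (μ i : AddCircle (1 : ℝ)) =
      ((∑ i, μ i • latticePoint (p i)) j : ℝ) := by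
    simp only [Finset.sum_apply, Pi.smul_apply, latticePoint, smul_eq_mul, coe_sum_addCircle]
    exact Finset.sum_congr rfl fun i _ => by rw [mul_comm, ← zsmul_eq_mul, AddCircle.coe_zsmul]
  change (∀ j, ∑ i, p i j • (μ i : AddCircle (1 : ℝ)) = 0) ∧
    ∑ i, (μ i : AddCircle (1 : ℝ)) = 0 ↔ _
  simp_rw [hcoord, ← coe_sum_addCircle, coe_addCircle_eq_zero_iff]
  refine and_congr_left' ⟨fun h => ?_, ?_⟩
  · choose z hz using h
    exact ⟨z, funext hz⟩
  · rintro ⟨z, hz⟩ j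
    exact ⟨z j, congrFun hz j⟩

/-- The weights `μ` of total mass `n` whose combination `∑ μ_i p_i` is a lattice point; these are
the barycentric coordinates, scaled by `n`, of the lattice points of the `n`-th dilate. -/
def latticeWeights {d : ℕ} (p : Fin (d + 1) → Fin d → ℤ) (n : ℕ) : Set (Fin (d + 1) → ℝ) :=
  {μ | (∀ i, 0 ≤ μ i) ∧ ∑ i, μ i = n ∧ (fun i => (μ i : AddCircle (1 : ℝ))) ∈ simplexGroup p}

theorem ncard_latticeWeights {d : ℕ} {p : Fin (d + 1) → Fin d → ℤ}
    (h : AffineIndependent ℝ (fun i => latticePoint (p i))) (n : ℕ) :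
    (((n : ℝ) • convexHull ℝ (Set.range fun i => latticePoint (p i))) ∩
      Set.range latticePoint).ncard = (latticeWeights p n).ncard := by
  have himage : ((n : ℝ) • convexHull ℝ (Set.range fun i => latticePoint (p i))) ∩
      Set.range latticePoint = (fun μ => ∑ i, μ i • latticePoint (p i)) '' latticeWeights p n := by
    ext y
    simp only [Set.mem_inter_iff, mem_smul_convexHull_range_iff _ n.cast_nonneg, latticeWeights,
      coe_mem_simplexGroup_iff, Set.mem_image, Set.mem_ofPred]
    constructor
    · rintro ⟨⟨μ, hμ, hn, rfl⟩, hy⟩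
      exact ⟨μ, ⟨hμ, hn, hy, n, by rw [hn, Int.cast_natCast]⟩, rfl⟩
    · rintro ⟨μ, ⟨hμ, hn, hy, -⟩, rfl⟩
      exact ⟨⟨μ, hμ, hn, rfl⟩, hy⟩
  rw [himage, Set.InjOn.ncard_image]
  intro μ hμ ν hν hμν
  ext i
  exact h.eq_of_sum_eq_sum (hμ.2.1.trans hν.2.1.symm) hμν i (Finset.mem_univ i)

/-- The exponents contributing to the coefficient of `X ^ n` in `X ^ h * (1 - X)⁻¹ ^ d`: the
solutions of `h + a_1 + ⋯ + a_d = n` in natural numbers. -/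
def shiftedCompositions (d h n : ℕ) : Finset (Fin d →₀ ℕ) :=
  if h ≤ n then Finset.finsuppAntidiag Finset.univ (n - h) else ∅

theorem mem_shiftedCompositions {d h n : ℕ} {a : Fin d →₀ ℕ} :
    a ∈ shiftedCompositions d h n ↔ h + ∑ i, a i = n := by
  rw [shiftedCompositions]
  split_ifs with hle
  · simp only [Finset.mem_finsuppAntidiag, Finset.subset_univ, and_true]
    change ∑ i, a i = n - h ↔ _
    omega
  · simp only [Finset.notMem_empty, false_iff]
    omega

theorem coeff_X_pow_mul_mk_one_pow (d h n : ℕ) :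
    PowerSeries.coeff n (PowerSeries.X ^ h * PowerSeries.mk 1 ^ d : PowerSeries ℤ) =
      (shiftedCompositions d h n).card := by
  have hprod : (PowerSeries.mk 1 : PowerSeries ℤ) ^ d = ∏ _i : Fin d, PowerSeries.mk 1 := by simp
  rw [PowerSeries.coeff_X_pow_mul', shiftedCompositions]
  split_ifs
  · rw [hprod, PowerSeries.coeff_prod]
    simp
  · simp

theorem ncard_latticeWeights_eq_sum {d : ℕ} {p : Fin (d + 1) → Fin d → ℤ}
    {G : Finset (Fin (d + 1) → AddCircle (1 : ℝ))} (hG : ∀ y, y ∈ G ↔ y ∈ simplexGroup p)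
    (n : ℕ) :
    (latticeWeights p n).ncard = ∑ y ∈ G, (shiftedCompositions (d + 1) (groupHeight y) n).card := by
  rw [← Finset.card_sigma, ← Set.ncard_coe_finset]
  -- A weight is split into its fractional part, an element of `Λ_Δ`, and its integral part.
  let split (μ : Fin (d + 1) → ℝ) : Σ _ : Fin (d + 1) → AddCircle (1 : ℝ), Fin (d + 1) →₀ ℕ :=
    ⟨fun i => μ i, Finsupp.equivFunOnFinite.symm fun i => ⌊μ i⌋₊⟩
  let join (u : Σ _ : Fin (d + 1) → AddCircle (1 : ℝ), Fin (d + 1) →₀ ℕ) : Fin (d + 1) → ℝ :=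
    fun i => circleFract (u.1 i) + u.2 i
  have hsplit : ∀ u, split (join u) = u := fun ⟨y, a⟩ => by
    simp only [split, join, coe_circleFract_add_natCast, floor_circleFract_add_natCast]
    congr
    ext i
    rfl
  have hjoin : ∀ μ ∈ latticeWeights p n, join (split μ) = μ := fun μ hμ =>
    funext fun i => circleFract_coe_add_floor (hμ.1 i)
  have hsum {y : Fin (d + 1) → AddCircle (1 : ℝ)} (hy : y ∈ simplexGroup p)
      (a : Fin (d + 1) →₀ ℕ) : ∑ i, join ⟨y, a⟩ i = (groupHeight y + ∑ i, a i : ℕ) := by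
    rw [Finset.sum_add_distrib, ← cast_groupHeight hy.2, Nat.cast_add, Nat.cast_sum]
  refine (Set.InvOn.bijOn ⟨hjoin, fun u _ => hsplit u⟩ (f := split) (f' := join) ?_ ?_).ncard_eq
  · intro μ hμ
    rw [Finset.mem_coe, Finset.mem_sigma, hG, mem_shiftedCompositions]
    refine ⟨hμ.2.2, Nat.cast_injective (R := ℝ) ?_⟩
    rw [← hsum hμ.2.2, ← hμ.2.1]
    exact congrArg (fun ν => ∑ i, ν i) (hjoin μ hμ)
  · rintro ⟨y, a⟩ hu
    rw [Finset.mem_coe, Finset.mem_sigma, hG, mem_shiftedCompositions] at hu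
    refine ⟨fun i => add_nonneg (circleFract_nonneg _) (Nat.cast_nonneg _), ?_, ?_⟩
    · rw [hsum hu.1, hu.2]
    · simpa only [join, coe_circleFract_add_natCast] using hu.1

theorem coeff_ehrhartSeries {d : ℕ} {P : Set (Fin d → ℝ)} (hP : P.Nonempty) (n : ℕ) :
    PowerSeries.coeff n (ehrhartSeries P) =
      ((((n : ℝ) • P) ∩ Set.range latticePoint).ncard : ℤ) := by
  rw [ehrhartSeries, PowerSeries.coeff_mk]
  split_ifs with h0
  · have hsingle : (0 : Set (Fin d → ℝ)) ∩ Set.range latticePoint = {0} :=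
      Set.inter_eq_left.2 fun x hx => ⟨0, by ext; simp [latticePoint, Set.mem_zero.1 hx]⟩
    rw [h0, Nat.cast_zero, Set.zero_smul_set hP, hsingle, Set.ncard_singleton, Nat.cast_one]
  · rfl

theorem ehrhartSeries_convexHull {d : ℕ} {p : Fin (d + 1) → Fin d → ℤ}
    (h : AffineIndependent ℝ (fun i => latticePoint (p i)))
    {G : Finset (Fin (d + 1) → AddCircle (1 : ℝ))} (hG : ∀ y, y ∈ G ↔ y ∈ simplexGroup p) :
    ehrhartSeries (convexHull ℝ (Set.range fun i => latticePoint (p i))) =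
      (∑ y ∈ G, PowerSeries.X ^ groupHeight y) * PowerSeries.mk 1 ^ (d + 1) := by
  ext n
  rw [coeff_ehrhartSeries (Set.range_nonempty _).convexHull, ncard_latticeWeights h,
    ncard_latticeWeights_eq_sum hG, Finset.sum_mul, map_sum, Nat.cast_sum]
  simp only [coeff_X_pow_mul_mk_one_pow]

theorem isDeltaPolynomial_convexHull_iff {d : ℕ} {p : Fin (d + 1) → Fin d → ℤ}
    (h : AffineIndependent ℝ (fun i => latticePoint (p i)))
    {G : Finset (Fin (d + 1) → AddCircle (1 : ℝ))} (hG : ∀ y, y ∈ G ↔ y ∈ simplexGroup p)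
    (f : Polynomial ℤ) :
    IsDeltaPolynomial (convexHull ℝ (Set.range fun i => latticePoint (p i))) f ↔
      ∑ y ∈ G, Polynomial.X ^ groupHeight y = f := by
  have hinv : (1 - PowerSeries.X : PowerSeries ℤ) ^ (d + 1) * PowerSeries.mk 1 ^ (d + 1) = 1 := by
    rw [← mul_pow, mul_comm, PowerSeries.mk_one_mul_one_sub_eq_one, one_pow]
  have hcoe : ((∑ y ∈ G, Polynomial.X ^ groupHeight y : Polynomial ℤ) : PowerSeries ℤ) =
      ∑ y ∈ G, PowerSeries.X ^ groupHeight y := by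
    rw [← Polynomial.coeToPowerSeries.ringHom_apply, map_sum]
    simp
  rw [IsDeltaPolynomial, ehrhartSeries_convexHull h hG, mul_left_comm, hinv, mul_one, ← hcoe,
    Polynomial.coe_inj, eq_comm]

/-! ### Unimodular equivalence of lattice simplices -/

section AffineBasis

variable {ι E : Type*} [AddCommGroup E] [Module ℝ E]

theorem affineBasis_mem_extremePoints [Finite ι] (B : AffineBasis ι ℝ E) (i : ι) :
    B i ∈ (convexHull ℝ (Set.range B)).extremePoints ℝ := by
  cases nonempty_fintype ι
  refine ⟨subset_convexHull ℝ _ ⟨i, rfl⟩, fun x hx y hy ⟨a, b, ha, hb, hab, hxy⟩ => ?_⟩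
  rw [B.convexHull_eq_nonneg_coord] at hx hy
  have hcoord : ∀ k ≠ i, B.coord k x = 0 := fun k hk => by
    have h0 : a * B.coord k x + b * B.coord k y = 0 := by
      rw [← smul_eq_mul, ← smul_eq_mul, ← Convex.combo_affine_apply hab, hxy,
        B.coord_apply_ne hk]
    have hxk := mul_nonneg ha.le (hx k)
    have hyk := mul_nonneg hb.le (hy k)
    exact (mul_eq_zero.1 (by linarith)).resolve_left ha.ne'
  refine B.ext_elem fun k => ?_
  rcases eq_or_ne k i with rfl | hk
  · rw [B.coord_apply_eq, ← B.sum_coord_apply_eq_one x,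
      Finset.sum_eq_single k (fun l _ hl => hcoord l hl) (by simp)]
  · rw [hcoord k hk, B.coord_apply_ne hk]

theorem range_affineBasis_subset_of_convexHull_eq [Finite ι] (B : AffineBasis ι ℝ E)
    {S : Set E} (h : convexHull ℝ (Set.range B) = convexHull ℝ S) : Set.range B ⊆ S :=
  Set.range_subset_iff.2 fun i =>
    extremePoints_convexHull_subset (h ▸ affineBasis_mem_extremePoints B i)

variable [Fintype ι] {F : Type*} [AddCommGroup F] [Module ℝ F]

/-- The affine map sending the vertices of an affine basis to prescribed points. -/
noncomputable def affineBasisLift (B : AffineBasis ι ℝ E) (q : ι → F) : E →ᵃ[ℝ] F :=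
  (Fintype.linearCombination ℝ q).toAffineMap.comp B.coords

theorem affineBasisLift_apply (B : AffineBasis ι ℝ E) (q : ι → F) (x : E) :
    affineBasisLift B q x = ∑ i, B.coord i x • q i :=
  rfl

theorem affineBasisLift_basis (B : AffineBasis ι ℝ E) (q : ι → F) (i : ι) :
    affineBasisLift B q (B i) = q i := by
  classical
  simp [affineBasisLift_apply, B.coord_apply, ite_smul]

end AffineBasis

/-- The vertices of a lattice simplex as an affine basis of `ℝ^d`. -/
noncomputable def vertexBasis {d : ℕ} {p : Fin (d + 1) → Fin d → ℤ}
    (h : AffineIndependent ℝ (fun i => latticePoint (p i))) :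
    AffineBasis (Fin (d + 1)) ℝ (Fin d → ℝ) :=
  ⟨fun i => latticePoint (p i), h,
    h.affineSpan_eq_top_iff_card_eq_finrank_add_one.2 (by simp)⟩

theorem coe_coord_mem_simplexGroup {d : ℕ} {p : Fin (d + 1) → Fin d → ℤ}
    (h : AffineIndependent ℝ (fun i => latticePoint (p i))) (z : Fin d → ℤ) :
    (fun i => ((vertexBasis h).coord i (latticePoint z) : AddCircle (1 : ℝ))) ∈
      simplexGroup p := by
  refine (coe_mem_simplexGroup_iff p fun i => (vertexBasis h).coord i (latticePoint z)).2
    ⟨⟨z, ?_⟩, 1, ?_⟩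
  · exact ((vertexBasis h).linear_combination_coord_eq_self _).symm
  · rw [AffineBasis.sum_coord_apply_eq_one, Int.cast_one]

theorem latticePoint_zero {d : ℕ} : latticePoint (0 : Fin d → ℤ) = 0 :=
  funext fun _ => Int.cast_zero

theorem latticePoint_single {d : ℕ} (l : Fin d) :
    latticePoint (Pi.single l 1) = Pi.single l (1 : ℝ) :=
  funext fun i => by simp [latticePoint, Pi.single_apply]

theorem latticeAffineMap_latticePoint {d : ℕ} (U : Matrix (Fin d) (Fin d) ℤ) (w z : Fin d → ℤ) :
    latticeAffineMap U w (latticePoint z) = latticePoint (Matrix.vecMul z U + w) := by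
  rw [latticeAffineMap, latticePoint_vecMul]
  ext i
  simp [latticePoint]

theorem exists_latticeAffineMap_eq {d : ℕ} {f : (Fin d → ℝ) →ᵃ[ℝ] (Fin d → ℝ)}
    (hf : ∀ z, f (latticePoint z) ∈ Set.range latticePoint) :
    ∃ U w, latticeAffineMap U w = f := by
  obtain ⟨w, hw⟩ := hf 0
  choose u hu using fun l : Fin d => hf (Pi.single l 1)
  simp only [latticePoint_zero, latticePoint_single] at hw hu
  refine ⟨Matrix.of fun l => u l - w, w, funext fun y => ?_⟩
  have hlinear (l : Fin d) : f.linear (Pi.single l 1) = latticePoint (u l) - latticePoint w := by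
    rw [hu, hw, ← vsub_eq_sub, ← f.linearMap_vsub, vsub_eq_sub, sub_zero]
  rw [congrFun f.decomp y, Pi.add_apply, ← hw, latticeAffineMap]
  congr 1
  ext j
  nth_rw 2 [← (Pi.basisFun ℝ (Fin d)).sum_repr y]
  simp [hlinear, Matrix.vecMul, dotProduct, latticePoint]

theorem exists_latticeAffineMap_of_simplexGroup_le {d : ℕ} {p q : Fin (d + 1) → Fin d → ℤ}
    (hp : AffineIndependent ℝ (fun i => latticePoint (p i)))
    (hpq : simplexGroup p ≤ simplexGroup q) :
    ∃ U w, ∀ i, latticeAffineMap U w (latticePoint (p i)) = latticePoint (q i) := by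
  obtain ⟨U, w, hU⟩ := exists_latticeAffineMap_eq
    (f := affineBasisLift (vertexBasis hp) fun i => latticePoint (q i)) fun z => by
      rw [affineBasisLift_apply]
      exact ((coe_mem_simplexGroup_iff q fun i => (vertexBasis hp).coord i (latticePoint z)).1
        (hpq (coe_coord_mem_simplexGroup hp z))).1
  exact ⟨U, w, fun i => hU ▸ affineBasisLift_basis (vertexBasis hp) _ i⟩

theorem exists_affineMap_eq_latticeAffineMap {d : ℕ} (U : Matrix (Fin d) (Fin d) ℤ)
    (w : Fin d → ℤ) : ∃ f : (Fin d → ℝ) →ᵃ[ℝ] (Fin d → ℝ), f = latticeAffineMap U w :=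
  ⟨(Matrix.vecMulLinear (U.map (Int.castRingHom ℝ))).toAffineMap +
    AffineMap.const ℝ _ (latticePoint w), rfl⟩

theorem latticeAffineMap_image_convexHull {d : ℕ} {ι : Type*} (U : Matrix (Fin d) (Fin d) ℤ)
    (w : Fin d → ℤ) (P : ι → Fin d → ℝ) :
    latticeAffineMap U w '' convexHull ℝ (Set.range P) =
      convexHull ℝ (Set.range fun i => latticeAffineMap U w (P i)) := by
  obtain ⟨f, hf⟩ := exists_affineMap_eq_latticeAffineMap U w
  rw [← hf, f.image_convexHull, ← Set.range_comp]
  rfl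

theorem mul_eq_one_of_latticeAffineMap_eq_id {d : ℕ} {U V : Matrix (Fin d) (Fin d) ℤ}
    {w z : Fin d → ℤ} (h : ∀ y, latticeAffineMap V z (latticeAffineMap U w y) = y) :
    U * V = 1 := by
  simp_rw [latticeAffineMap_comp] at h
  set t := Matrix.vecMul w V + z
  have ht : t = 0 := latticePoint_injective <| by
    simpa [← latticePoint_zero, latticeAffineMap_latticePoint] using h 0
  refine Matrix.ext_of_single_vecMul fun l => latticePoint_injective ?_
  simpa only [latticeAffineMap_latticePoint, ht, add_zero, Matrix.vecMul_one] using
    h (latticePoint (Pi.single l 1))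

theorem unimodularlyEquivalent_of_simplexGroup_eq {d : ℕ} {p q : Fin (d + 1) → Fin d → ℤ}
    (hp : AffineIndependent ℝ (fun i => latticePoint (p i)))
    (hq : AffineIndependent ℝ (fun i => latticePoint (q i)))
    (hpq : simplexGroup p = simplexGroup q) :
    UnimodularlyEquivalent (convexHull ℝ (Set.range fun i => latticePoint (p i)))
      (convexHull ℝ (Set.range fun i => latticePoint (q i))) := by
  obtain ⟨U, w, hU⟩ := exists_latticeAffineMap_of_simplexGroup_le hp hpq.le
  obtain ⟨V, z, hV⟩ := exists_latticeAffineMap_of_simplexGroup_le hq hpq.ge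
  obtain ⟨f, hf⟩ := exists_affineMap_eq_latticeAffineMap U w
  obtain ⟨g, hg⟩ := exists_affineMap_eq_latticeAffineMap V z
  have hgf : g.comp f = AffineMap.id ℝ (Fin d → ℝ) :=
    AffineMap.ext_on (vertexBasis hp).tot <| Set.forall_mem_range.2 fun i => by
      rw [AffineMap.comp_apply, hf, hg]
      exact (congrArg _ (hU i)).trans (hV i)
  have hUV : U * V = 1 := mul_eq_one_of_latticeAffineMap_eq_id fun y => by
    rw [← hf, ← hg, ← AffineMap.comp_apply, hgf, AffineMap.id_apply]
  refine ⟨U, w, Int.isUnit_iff.1 (IsUnit.of_mul_eq_one V.det ?_), ?_⟩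
  · rw [← Matrix.det_mul, hUV, Matrix.det_one]
  · simp_rw [latticeAffineMap_image_convexHull, hU]

theorem simplexGroup_le_of_affine {d : ℕ} (p : Fin (d + 1) → Fin d → ℤ)
    (U : Matrix (Fin d) (Fin d) ℤ) (w : Fin d → ℤ) :
    simplexGroup p ≤ simplexGroup fun i => Matrix.vecMul (p i) U + w := by
  rintro x ⟨hx, hx'⟩
  refine ⟨fun j => ?_, hx'⟩
  calc ∑ i, (Matrix.vecMul (p i) U + w) j • x i
      = ∑ l, U l j • ∑ i, p i l • x i + w j • ∑ i, x i := by
        simp only [Pi.add_apply, Matrix.vecMul, dotProduct, add_smul, Finset.sum_add_distrib,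
          Finset.sum_smul, Finset.smul_sum, mul_comm (p _ _), mul_smul]
        rw [Finset.sum_comm]
    _ = 0 := by simp [hx, hx']

theorem simplexGroup_affine {d : ℕ} (p : Fin (d + 1) → Fin d → ℤ)
    {U : Matrix (Fin d) (Fin d) ℤ} (hU : IsUnit U.det) (w : Fin d → ℤ) :
    (simplexGroup fun i => Matrix.vecMul (p i) U + w) = simplexGroup p := by
  refine le_antisymm ?_ (simplexGroup_le_of_affine p U w)
  simpa [Matrix.add_vecMul, Matrix.mul_nonsing_inv U hU] using
    simplexGroup_le_of_affine (fun i => Matrix.vecMul (p i) U + w) U⁻¹ (-Matrix.vecMul w U⁻¹)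

theorem comp_mem_simplexGroup_comp_iff {d : ℕ} (p : Fin (d + 1) → Fin d → ℤ)
    (σ : Equiv.Perm (Fin (d + 1))) (x : Fin (d + 1) → AddCircle (1 : ℝ)) :
    x ∘ σ ∈ simplexGroup (p ∘ σ) ↔ x ∈ simplexGroup p :=
  and_congr (forall_congr' fun j => by rw [← Equiv.sum_comp σ fun i => p i j • x i]; rfl)
    (by rw [← Equiv.sum_comp σ x]; rfl)

theorem exists_perm_comp_mem_simplexGroup_iff {d : ℕ} {P Q : Set (Fin d → ℝ)}
    {p q : Fin (d + 1) → Fin d → ℤ} (hp : IsVertexOrdering P p) (hq : IsVertexOrdering Q q)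
    (h : UnimodularlyEquivalent P Q) :
    ∃ σ : Equiv.Perm (Fin (d + 1)), ∀ x, x ∘ σ ∈ simplexGroup p ↔ x ∈ simplexGroup q := by
  obtain ⟨V, z, hV, hP⟩ := (unimodularlyEquivalent_equivalence d).symm h
  obtain ⟨hp, rfl⟩ := hp
  obtain ⟨-, rfl⟩ := hq
  simp_rw [latticeAffineMap_image_convexHull, latticeAffineMap_latticePoint] at hP
  set q' := fun i => Matrix.vecMul (q i) V + z with hq'
  have hvertex : ∀ i, ∃ j, q' j = p i := fun i => by
    obtain ⟨j, hj⟩ := range_affineBasis_subset_of_convexHull_eq (vertexBasis hp) hP ⟨i, rfl⟩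
    exact ⟨j, latticePoint_injective hj⟩
  choose σ hσ using hvertex
  have hinj : Function.Injective σ := fun i j hij =>
    hp.injective (by simp only [← hσ, hij])
  let τ := Equiv.ofBijective σ (Finite.injective_iff_bijective.1 hinj)
  have hpτ : p = q' ∘ τ := funext fun i => (hσ i).symm
  refine ⟨τ, fun x => ?_⟩
  rw [hpτ, comp_mem_simplexGroup_comp_iff, hq', simplexGroup_affine q (Int.isUnit_iff.2 hV) z]

/-! ### Gorenstein simplices -/

section Dual

variable {ι : Type*} {d : ℕ} (B : AffineBasis ι ℝ (Fin d → ℝ))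

/-- The gradient of the `i`-th barycentric coordinate. -/
noncomputable def coordGradient (i : ι) : Fin d → ℝ :=
  fun l => (B.coord i).linear (Pi.single l 1)

theorem dotProduct_coordGradient (i : ι) (y : Fin d → ℝ) :
    y ⬝ᵥ coordGradient B i = B.coord i y - B.coord i 0 := by
  rw [← vsub_eq_sub, ← (B.coord i).linearMap_vsub, vsub_eq_sub, sub_zero]
  nth_rw 2 [← (Pi.basisFun ℝ (Fin d)).sum_repr y]
  simp [dotProduct, coordGradient]

theorem coordGradient_apply (i : ι) (l : Fin d) :
    coordGradient B i l = B.coord i (Pi.single l 1) - B.coord i 0 := by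
  rw [← dotProduct_coordGradient, single_one_dotProduct]

theorem mem_dualPolytope_convexHull_range (P : ι → Fin d → ℝ) (y : Fin d → ℝ) :
    y ∈ dualPolytope (convexHull ℝ (Set.range P)) ↔ ∀ i, P i ⬝ᵥ y ≤ 1 := by
  refine ⟨fun h i => h _ (subset_convexHull ℝ _ ⟨i, rfl⟩), fun h x hx => ?_⟩
  have hconvex : Convex ℝ {x : Fin d → ℝ | x ⬝ᵥ y ≤ 1} :=
    convex_halfSpace_le ⟨fun _ _ => add_dotProduct _ _ _, fun _ _ => smul_dotProduct _ _ _⟩ 1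
  exact convexHull_min (Set.range_subset_iff.2 h) hconvex hx

theorem convex_dualPolytope (P : Set (Fin d → ℝ)) : Convex ℝ (dualPolytope P) := by
  have hinter : dualPolytope P = ⋂ x ∈ P, {y | x ⬝ᵥ y ≤ 1} := by
    ext y
    simp [dualPolytope]
  rw [hinter]
  exact convex_iInter₂ fun x _ =>
    convex_halfSpace_le ⟨fun _ _ => dotProduct_add _ _ _, fun _ _ => dotProduct_smul _ _ _⟩ 1

theorem isLatticePolytope_convexHull_range [Finite ι] {P : ι → Fin d → ℝ}
    (hP : ∀ i, P i ∈ Set.range (latticePoint (d := d))) :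
    IsLatticePolytope (convexHull ℝ (Set.range P)) := by
  classical
  cases nonempty_fintype ι
  choose q hq using hP
  refine ⟨Finset.univ.image q, ?_⟩
  rw [Finset.coe_image, Finset.coe_univ, Set.image_univ, ← Set.range_comp]
  exact congrArg _ (congrArg _ (funext fun i => (hq i).symm))

section Fintype

variable [Fintype ι]

theorem sum_coordGradient : ∑ i, coordGradient B i = 0 := by
  ext l
  simp [Finset.sum_apply, coordGradient_apply, B.sum_coord_apply_eq_one]

theorem sum_coord_zero_mul_dotProduct (y : Fin d → ℝ) :
    ∑ i, B.coord i 0 * (B i ⬝ᵥ y) = 0 := by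
  simpa only [sum_dotProduct, smul_dotProduct, smul_eq_mul, zero_dotProduct] using
    congrArg (· ⬝ᵥ y) (B.linear_combination_coord_eq_self 0)

theorem sum_dotProduct_smul_coordGradient (y : Fin d → ℝ) :
    ∑ i, (B i ⬝ᵥ y) • coordGradient B i = y := by
  refine dotProduct_eq _ _ fun x => ?_
  have hx : x ⬝ᵥ y = ∑ i, B.coord i x * (B i ⬝ᵥ y) := by
    simpa only [sum_dotProduct, smul_dotProduct, smul_eq_mul] using
      congrArg (· ⬝ᵥ y) (B.linear_combination_coord_eq_self x).symm
  rw [dotProduct_comm y, hx, dotProduct_comm _ x]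
  simp only [dotProduct_sum, dotProduct_smul, dotProduct_coordGradient, smul_eq_mul,
    mul_comm (B _ ⬝ᵥ y), sub_mul, Finset.sum_sub_distrib]
  rw [sum_coord_zero_mul_dotProduct, sub_zero]

end Fintype

variable [Finite ι]

theorem dualPolytope_convexHull_range (hpos : ∀ i, 0 < B.coord i 0) :
    dualPolytope (convexHull ℝ (Set.range B)) =
      convexHull ℝ (Set.range fun i => -(B.coord i 0)⁻¹ • coordGradient B i) := by
  cases nonempty_fintype ι
  refine Set.Subset.antisymm (fun y hy => ?_) (convexHull_min ?_ (convex_dualPolytope _))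
  · rw [mem_dualPolytope_convexHull_range] at hy
    have hexpand : y = ∑ i, (B.coord i 0 * (1 - B i ⬝ᵥ y)) •
        (-(B.coord i 0)⁻¹ • coordGradient B i) :=
      calc y = ∑ i, (B i ⬝ᵥ y) • coordGradient B i - ∑ i, coordGradient B i := by
            rw [sum_dotProduct_smul_coordGradient, sum_coordGradient, sub_zero]
        _ = _ := by
            rw [← Finset.sum_sub_distrib]
            refine Finset.sum_congr rfl fun i _ => ?_
            have := (hpos i).ne'
            rw [smul_smul, show B.coord i 0 * (1 - B i ⬝ᵥ y) * -(B.coord i 0)⁻¹ = B i ⬝ᵥ y - 1 by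
              field_simp; ring, sub_smul, one_smul]
    rw [hexpand]
    refine (convex_convexHull ℝ _).sum_mem
      (fun i _ => mul_nonneg (hpos i).le (sub_nonneg.2 (hy i))) ?_
      fun i _ => subset_convexHull ℝ _ ⟨i, rfl⟩
    simp only [mul_sub, mul_one, Finset.sum_sub_distrib]
    rw [sum_coord_zero_mul_dotProduct, sub_zero, B.sum_coord_apply_eq_one]
  · rintro _ ⟨j, rfl⟩
    refine (mem_dualPolytope_convexHull_range _ _).2 fun i => ?_
    have hcoord : 0 ≤ (B.coord j 0)⁻¹ * B.coord j (B i) :=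
      mul_nonneg (inv_nonneg.2 (hpos j).le) (by classical rw [B.coord_apply]; positivity)
    rw [dotProduct_smul, dotProduct_coordGradient, smul_eq_mul, neg_mul, mul_sub,
      inv_mul_cancel₀ (hpos j).ne']
    linarith

theorem isReflexive_convexHull_range (hpos : ∀ i, 0 < B.coord i 0)
    (hB : ∀ i, B i ∈ Set.range (latticePoint (d := d)))
    (hdual : ∀ i, -(B.coord i 0)⁻¹ • coordGradient B i ∈ Set.range latticePoint) :
    IsReflexive (convexHull ℝ (Set.range B)) := by
  refine ⟨isLatticePolytope_convexHull_range hB, ?_, ?_⟩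
  · rw [B.interior_convexHull]
    exact hpos
  · rw [dualPolytope_convexHull_range B hpos]
    exact isLatticePolytope_convexHull_range hdual

end Dual

theorem natCast_mul_coord_mem_range {d : ℕ} {p : Fin (d + 1) → Fin d → ℤ}
    (h : AffineIndependent ℝ (fun i => latticePoint (p i))) {m : ℕ} {j : Fin (d + 1)}
    (hm : ∀ x ∈ simplexGroup p, m • x j = 0) (z : Fin d → ℤ) :
    m * (vertexBasis h).coord j (latticePoint z) ∈ Set.range ((↑) : ℤ → ℝ) := by
  rw [← coe_addCircle_eq_zero_iff, ← nsmul_eq_mul, AddCircle.coe_nsmul]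
  exact hm _ (coe_coord_mem_simplexGroup h z)

theorem neg_natCast_smul_coordGradient_mem_range {d : ℕ} {p : Fin (d + 1) → Fin d → ℤ}
    (h : AffineIndependent ℝ (fun i => latticePoint (p i))) {m : ℕ} {j : Fin (d + 1)}
    (hm : ∀ x ∈ simplexGroup p, m • x j = 0) :
    -(m : ℝ) • coordGradient (vertexBasis h) j ∈ Set.range (latticePoint (d := d)) := by
  obtain ⟨b, hb⟩ := natCast_mul_coord_mem_range h hm 0
  choose a ha using fun l => natCast_mul_coord_mem_range h hm (Pi.single l 1)
  refine ⟨fun l => b - a l, funext fun l => ?_⟩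
  rw [latticePoint_zero] at hb
  simp only [latticePoint_single] at ha
  rw [latticePoint, Int.cast_sub, hb, ha, Pi.smul_apply, coordGradient_apply, smul_eq_mul]
  ring

theorem coord_sum_smul {ι : Type*} [Fintype ι] {E : Type*} [AddCommGroup E] [Module ℝ E]
    (B : AffineBasis ι ℝ E) {w : ι → ℝ} (hw : ∑ i, w i = 1) (i : ι) :
    B.coord i (∑ j, w j • B j) = w i := by
  rw [← Finset.univ.affineCombination_eq_linear_combination B w hw,
    B.coord_apply_combination_of_mem (Finset.mem_univ i) hw]

theorem coord_vadd_smul {ι E : Type*} [AddCommGroup E] [Module ℝ E] (B : AffineBasis ι ℝ E)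
    (v : E) (a : ℝˣ) (i : ι) (x : E) :
    (v +ᵥ a • B).coord i x = B.coord i ((a⁻¹ : ℝ) • (x - v)) := by
  rw [← Units.val_inv_eq_inv_val, ← Units.smul_def, AffineBasis.coord_vadd, sub_eq_neg_add]
  simp

theorem coordGradient_vadd_smul {ι : Type*} {d : ℕ} (B : AffineBasis ι ℝ (Fin d → ℝ))
    (v : Fin d → ℝ) (a : ℝˣ) (i : ι) :
    coordGradient (v +ᵥ a • B) i = (a⁻¹ : ℝ) • coordGradient B i := by
  ext l
  rw [coordGradient_apply, coord_vadd_smul, coord_vadd_smul, ← vsub_eq_sub,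
    ← AffineMap.linearMap_vsub, vsub_eq_sub, ← smul_sub, sub_sub_sub_cancel_right, sub_zero,
    map_smul, Pi.smul_apply, coordGradient]

/-- The point `z` has lattice distance `1` from every facet of the `n`-th dilate, so that moving it
to the origin makes the dilate reflexive. -/
theorem isGorenstein_of_coord_eq {d : ℕ} {p : Fin (d + 1) → Fin d → ℤ}
    (h : AffineIndependent ℝ (fun i => latticePoint (p i))) {c : Fin (d + 1) → ℕ}
    (hc : ∀ i, 0 < c i) (hker : ∀ x ∈ simplexGroup p, ∀ i, c i • x i = 0) {n : ℕ} (hn : 0 < n)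
    (z : Fin d → ℤ)
    (hz : ∀ i, (vertexBasis h).coord i ((n : ℝ)⁻¹ • latticePoint z) = (c i * n : ℝ)⁻¹) :
    IsGorenstein (convexHull ℝ (Set.range fun i => latticePoint (p i))) := by
  have hn0 : (n : ℝ) ≠ 0 := Nat.cast_ne_zero.2 hn.ne'
  let a : ℝˣ := Units.mk0 n hn0
  let B := -latticePoint z +ᵥ a • vertexBasis h
  have hB : ∀ i, B i = latticeAffineMap 1 (-z) ((n : ℝ) • latticePoint (p i)) := fun i => by
    ext l
    have hBi : B i l = -(z l : ℝ) + n * p i l := rfl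
    simp [hBi, latticeAffineMap, latticePoint, add_comm]
  have hnp : ∀ i, (n : ℝ) • latticePoint (p i) = latticePoint (n • p i) := fun i => by
    ext l
    simp [latticePoint]
  have hcoord : ∀ i, B.coord i 0 = (c i * n : ℝ)⁻¹ := fun i => by
    rw [coord_vadd_smul, zero_sub, neg_neg]
    exact hz i
  refine ⟨n, hn, _, isReflexive_convexHull_range B (fun i => ?_) (fun i => ?_) (fun i => ?_),
    1, -z, Or.inl Matrix.det_one, ?_⟩
  · rw [hcoord]
    exact inv_pos.2 (mul_pos (Nat.cast_pos.2 (hc i)) (Nat.cast_pos.2 hn))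
  · rw [hB, hnp, latticeAffineMap_latticePoint]
    exact ⟨_, rfl⟩
  · rw [hcoord, coordGradient_vadd_smul, smul_smul, inv_inv, Units.val_mk0, neg_mul,
      mul_inv_cancel_right₀ hn0]
    exact neg_natCast_smul_coordGradient_mem_range h fun x hx => hker x hx i
  · rw [← convexHull_smul, Set.smul_set_range, latticeAffineMap_image_convexHull]
    exact congrArg _ (congrArg _ (funext hB))

theorem isGorenstein_of_denominators {d : ℕ} {p : Fin (d + 1) → Fin d → ℤ}
    (h : AffineIndependent ℝ (fun i => latticePoint (p i))) {c : Fin (d + 1) → ℕ}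
    (hc : ∀ i, 0 < c i) (hker : ∀ x ∈ simplexGroup p, ∀ i, c i • x i = 0)
    (hmem : (fun i => ((1 / (c i : ℝ) : ℝ) : AddCircle (1 : ℝ))) ∈ simplexGroup p) :
    IsGorenstein (convexHull ℝ (Set.range fun i => latticePoint (p i))) := by
  obtain ⟨⟨z, hz⟩, n, hn⟩ := (coe_mem_simplexGroup_iff p fun i => 1 / (c i : ℝ)).1 hmem
  have hpos : (0 : ℝ) < ∑ i, 1 / (c i : ℝ) :=
    Finset.sum_pos (fun i _ => one_div_pos.2 (Nat.cast_pos.2 (hc i))) Finset.univ_nonempty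
  rw [← hn, Int.cast_pos] at hpos
  lift n to ℕ using hpos.le
  rw [Int.natCast_pos] at hpos
  refine isGorenstein_of_coord_eq h hc hker hpos z fun i => ?_
  rw [hz, Finset.smul_sum]
  simp only [smul_smul]
  refine (coord_sum_smul (vertexBasis h) ?_ i).trans (by rw [one_div, mul_inv_rev])
  rw [← Finset.mul_sum, ← hn, Int.cast_natCast, inv_mul_cancel₀ (Nat.cast_ne_zero.2 hpos.ne')]

/-! ### Simplices whose group is generated by unit fractions -/

/-- The vector of the classes of `1 / e j` in `ℝ/ℤ`. -/
noncomputable def unitFractions {ι : Type*} (e : ι → ℕ) : ι → AddCircle (1 : ℝ) :=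
  fun j => ((1 / (e j : ℝ) : ℝ) : AddCircle (1 : ℝ))

/-- The number of indices where `e` takes the value `c`: the `s_i` belonging to `v_i = c`. -/
def fiberCard {ι : Type*} [Fintype ι] (e : ι → ℕ) (c : ℕ) : ℕ :=
  (Finset.univ.filter fun j => e j = c).card

section UnitFractions

variable {ι : Type*} {e : ι → ℕ}

theorem nsmul_unitFractions_apply (e : ι → ℕ) (a : ℕ) (j : ι) :
    a • unitFractions e j = ((a / e j : ℝ) : AddCircle (1 : ℝ)) := by
  rw [unitFractions, ← AddCircle.coe_nsmul, nsmul_eq_mul, mul_one_div]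

theorem nsmul_unitFractions_apply_eq_zero_iff {j : ι} (hj : 0 < e j) (a : ℕ) :
    a • unitFractions e j = 0 ↔ e j ∣ a := by
  rw [← addOrderOf_dvd_iff_nsmul_eq_zero, unitFractions, AddCircle.addOrderOf_period_div hj]

theorem addOrderOf_unitFractions (he : ∀ i, 0 < e i) {j : ι} (hdvd : ∀ i, e i ∣ e j) :
    addOrderOf (unitFractions e) = e j := by
  refine Nat.dvd_antisymm (addOrderOf_dvd_of_nsmul_eq_zero (funext fun i => ?_)) ?_
  · exact (nsmul_unitFractions_apply_eq_zero_iff (he i) _).2 (hdvd i)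
  · exact (nsmul_unitFractions_apply_eq_zero_iff (he j) _).1
      (congrFun (addOrderOf_nsmul_eq_zero (unitFractions e)) j)

theorem nsmul_eq_zero_of_mem_zmultiples_unitFractions (he : ∀ i, 0 < e i)
    {x : ι → AddCircle (1 : ℝ)} (hx : x ∈ AddSubgroup.zmultiples (unitFractions e)) (i : ι) :
    e i • x i = 0 := by
  obtain ⟨n, rfl⟩ := AddSubgroup.mem_zmultiples_iff.1 hx
  rw [Pi.smul_apply, smul_comm, (nsmul_unitFractions_apply_eq_zero_iff (he i) _).2 dvd_rfl,
    smul_zero]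

theorem forall_mem_zmultiples_unitFractions_nsmul_eq_zero_iff (he : ∀ i, 0 < e i) (i : ι) (a : ℕ) :
    (∀ x ∈ AddSubgroup.zmultiples (unitFractions e), a • x i = 0) ↔ e i ∣ a := by
  refine ⟨fun h => ?_, fun ⟨b, hb⟩ x hx => ?_⟩
  · exact (nsmul_unitFractions_apply_eq_zero_iff (he i) a).1 (h _ (AddSubgroup.mem_zmultiples _))
  · rw [hb, mul_comm, mul_smul, nsmul_eq_zero_of_mem_zmultiples_unitFractions he hx, smul_zero]

variable [Fintype ι]

theorem sum_circleFract_nsmul_unitFractions (e : ι → ℕ) (a : ℕ) :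
    ∑ j, circleFract ((a • unitFractions e) j) =
      fractSum (Finset.univ.image e) (fiberCard e) a := by
  have hfract (j : ι) : circleFract ((a • unitFractions e) j) = (a % e j : ℕ) / (e j : ℝ) := by
    rw [Pi.smul_apply, nsmul_unitFractions_apply, circleFract_coe,
      Int.fract_div_natCast_eq_div_natCast_mod]
  simp_rw [hfract]
  rw [Finset.sum_comp fun c : ℕ => (a % c : ℕ) / (c : ℝ)]
  simp only [nsmul_eq_mul, fractSum, fiberCard]

theorem fiberCard_pos_iff {c : ℕ} : 0 < fiberCard e c ↔ c ∈ Finset.univ.image e := by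
  simp [fiberCard, Finset.card_pos, Finset.filter_nonempty_iff]

end UnitFractions

section Tower

variable {ι : Type*} [Fintype ι] {e : ι → ℕ} {v : ℕ}

theorem pos_of_isDivisorTower_image (he : IsDivisorTower v (Finset.univ.image e)) (j : ι) :
    0 < e j :=
  zero_lt_one.trans (he.one_lt_of_mem (Finset.mem_image_of_mem e (Finset.mem_univ j)))

theorem one_lt_of_isDivisorTower_image [Nonempty ι]
    (he : IsDivisorTower v (Finset.univ.image e)) : 1 < v :=
  have hj := Finset.mem_image_of_mem e (Finset.mem_univ (Classical.arbitrary ι))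
  (he.one_lt_of_mem hj).trans_le (he.le_of_mem hj)

theorem exists_eq_of_isDivisorTower_image [Nonempty ι]
    (he : IsDivisorTower v (Finset.univ.image e)) : ∃ j, e j = v := by
  simpa using he.top_mem (one_lt_of_isDivisorTower_image he).ne'

theorem addOrderOf_unitFractions_of_isDivisorTower [Nonempty ι]
    (he : IsDivisorTower v (Finset.univ.image e)) : addOrderOf (unitFractions e) = v := by
  obtain ⟨j, rfl⟩ := exists_eq_of_isDivisorTower_image he
  exact addOrderOf_unitFractions (pos_of_isDivisorTower_image he) fun i =>
    he.dvd_of_mem (Finset.mem_image_of_mem e (Finset.mem_univ i))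

theorem sum_unitFractions_eq_zero [Nonempty ι] {K : ℕ}
    (he : IsDivisorTower v (Finset.univ.image e))
    (h : HasArithmeticHeights (Finset.univ.image e) v K (fiberCard e)) :
    ∑ j, unitFractions e j = 0 := by
  obtain ⟨f, hf, -⟩ := h
  have hone := hf 1 (one_lt_of_isDivisorTower_image he)
  rw [← sum_circleFract_nsmul_unitFractions, one_smul] at hone
  calc ∑ j, unitFractions e j = ∑ j, (circleFract (unitFractions e j) : AddCircle (1 : ℝ)) := by
        simp only [coe_circleFract]
    _ = ((f 1 : ℝ) : AddCircle (1 : ℝ)) := by rw [← coe_sum_addCircle, ← hone]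
    _ = 0 := (coe_addCircle_eq_zero_iff _).2 ⟨f 1, Int.cast_natCast _⟩

end Tower

theorem isDeltaPolynomial_iff_hasArithmeticHeights {d v K : ℕ} {p : Fin (d + 1) → Fin d → ℤ}
    (h : AffineIndependent ℝ (fun i => latticePoint (p i))) {e : Fin (d + 1) → ℕ}
    (he : IsDivisorTower v (Finset.univ.image e))
    (hp : simplexGroup p = AddSubgroup.zmultiples (unitFractions e)) :
    IsDeltaPolynomial (convexHull ℝ (Set.range fun i => latticePoint (p i)))
        (∑ i ∈ Finset.range v, Polynomial.X ^ (i * K)) ↔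
      HasArithmeticHeights (Finset.univ.image e) v K (fiberCard e) := by
  classical
  have hord := addOrderOf_unitFractions_of_isDivisorTower he
  have hfin : IsOfFinAddOrder (unitFractions e) :=
    addOrderOf_pos_iff.1 (hord ▸ he.pos)
  have hinj : Set.InjOn (fun a : ℕ => a • unitFractions e) (Finset.range v) := by
    rw [Finset.coe_range, ← hord]
    exact nsmul_injOn_Iio_addOrderOf
  have hmem : ∀ y, y ∈ (Finset.range v).image (fun a : ℕ => a • unitFractions e) ↔
      y ∈ simplexGroup p := fun y => by
    rw [hp, hfin.mem_zmultiples_iff_mem_range_addOrderOf, hord]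
  have hheight : ∀ a : ℕ, (groupHeight (a • unitFractions e) : ℝ) =
      fractSum (Finset.univ.image e) (fiberCard e) a := fun a => by
    have hmem : a • unitFractions e ∈ simplexGroup p :=
      hp ▸ AddSubgroup.nsmul_mem_zmultiples _ _
    rw [cast_groupHeight hmem.2, sum_circleFract_nsmul_unitFractions]
  rw [isDeltaPolynomial_convexHull_iff h hmem, Finset.sum_image hinj]
  refine ⟨fun hδ => ⟨_, fun a _ => hheight a, hδ⟩, fun ⟨f, hf, hsum⟩ => ?_⟩
  rw [← hsum]
  refine Finset.sum_congr rfl fun a ha => ?_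
  rw [show groupHeight (a • unitFractions e) = f a from
    Nat.cast_injective ((hheight a).trans (hf a (Finset.mem_range.1 ha)).symm)]

section BlockVector

variable {v d : ℕ} {x : Fin (d + 1) → AddCircle (1 : ℝ)}

theorem exists_eq_unitFractions_of_isDivisorBlockVector (h : IsDivisorBlockVector v x) :
    ∃ e : Fin (d + 1) → ℕ,
      Monotone e ∧ IsDivisorTower v (Finset.univ.image e) ∧ x = unitFractions e := by
  obtain ⟨m, c, b, hc0, hc, hdvd, rfl, hb, hb', hx⟩ := h
  refine ⟨c ∘ b, hc.monotone.comp hb, ?_, funext hx⟩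
  have hdvd : ∀ i j, i ≤ j → c i ∣ c j := fun i j hij =>
    hij.eq_or_lt.elim (fun h => h ▸ dvd_rfl) fun h => (Fin.liftFun_iff_succ (· ∣ ·)).2 hdvd h
  have hone : ∀ i, 1 < c i := fun i => hc0.trans_le (hc.monotone (Fin.zero_le i))
  rw [← Finset.image_image, Finset.image_univ_of_surjective hb']
  refine IsDivisorTower.of_isChain ?_ ?_ (Finset.mem_image_of_mem c (Finset.mem_univ _))
    (zero_lt_one.trans (hone _)) ?_
  · simpa using fun i => hdvd i _ (Fin.le_last i)
  · rw [Finset.coe_image, Finset.coe_univ, Set.image_univ]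
    rintro _ ⟨i, rfl⟩ _ ⟨j, rfl⟩ -
    exact (le_total i j).imp (hdvd i j) (hdvd j i)
  · simpa using fun i => (hone i).ne'

theorem isDivisorBlockVector_unitFractions {e : Fin (d + 1) → ℕ} (he : Monotone e)
    (hC : IsDivisorTower v (Finset.univ.image e)) : IsDivisorBlockVector v (unitFractions e) := by
  set C := Finset.univ.image e
  have hmem : ∀ j, e j ∈ C := fun j => Finset.mem_image_of_mem e (Finset.mem_univ j)
  obtain ⟨m, hm⟩ : ∃ m, C.card = m + 1 :=
    Nat.exists_eq_add_one.2 (Finset.card_pos.2 ⟨_, hmem 0⟩)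
  let c := C.orderEmbOfFin hm
  have hc : ∀ i, c i ∈ C := C.orderEmbOfFin_mem hm
  have hsurj : ∀ a ∈ C, ∃ i, c i = a := fun a ha => by
    rwa [← Finset.mem_coe, ← C.range_orderEmbOfFin hm] at ha
  choose b hb using fun j => hsurj _ (hmem j)
  refine ⟨m, c, b, hC.one_lt_of_mem (hc 0), c.strictMono, fun i => ?_, ?_, fun i j hij => ?_,
    fun i => ?_, fun j => by rw [hb]; rfl⟩
  · exact hC.dvd_of_le (hc _) (hc _) (c.monotone i.castSucc_le_succ)
  · obtain ⟨i, hi⟩ := hsurj v (hC.top_mem (one_lt_of_isDivisorTower_image hC).ne')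
    exact (hC.le_of_mem (hc _)).antisymm (hi ▸ c.monotone (Fin.le_last i))
  · exact c.le_iff_le.1 (by simpa only [hb] using he hij)
  · obtain ⟨j, -, hj⟩ := Finset.mem_image.1 (hc i)
    exact ⟨j, c.injective ((hb j).trans hj)⟩

end BlockVector

section UnitFractionVertex

variable {n : ℕ} {e : Fin (n + 2) → ℕ}

/-- The vertices of a lattice simplex whose group is generated by `unitFractions e`, provided that
every `e i` divides the last one and that the fractions `1 / e i` sum to an integer. The vertices
are `0`, the standard basis vectors except the first one, and the vector
`(v, -v / e 1, …, -v / e n)` where `v = e (n + 1)`. -/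
def unitFractionVertex (e : Fin (n + 2) → ℕ) : Fin (n + 2) → Fin (n + 1) → ℤ :=
  Fin.snoc (α := fun _ => Fin (n + 1) → ℤ) (fun i => if i = 0 then 0 else Pi.single i 1)
    fun l => if l = 0 then (e (Fin.last _) : ℤ) else -((e (Fin.last _) / e l.castSucc : ℕ) : ℤ)

section Sum

variable {M : Type*} [AddCommGroup M] {y : Fin (n + 2) → M}

theorem sum_unitFractionVertex_smul (e : Fin (n + 2) → ℕ) (y : Fin (n + 2) → M)
    (l : Fin (n + 1)) :
    ∑ i, unitFractionVertex e i l • y i =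
      if l = 0 then e (Fin.last _) • y (Fin.last _)
      else y l.castSucc - (e (Fin.last _) / e l.castSucc) • y (Fin.last _) := by
  rw [Fin.sum_univ_castSucc]
  simp only [unitFractionVertex, Fin.snoc_castSucc, Fin.snoc_last]
  split_ifs with hl
  · rw [Finset.sum_eq_zero fun i _ => ?_, zero_add, natCast_zsmul]
    split_ifs with hi
    · rw [Pi.zero_apply, zero_smul]
    · rw [hl, Pi.single_eq_of_ne' hi, zero_smul]
  · rw [Finset.sum_eq_single l (fun i _ hil => ?_) (by simp), if_neg hl, Pi.single_eq_same,
      one_smul, neg_smul, natCast_zsmul, sub_eq_add_neg]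
    split_ifs with hi
    · rw [Pi.zero_apply, zero_smul]
    · rw [Pi.single_eq_of_ne' hil, zero_smul]

theorem last_nsmul_eq_zero_of_sum_unitFractionVertex_smul
    (hy : ∀ l, ∑ i, unitFractionVertex e i l • y i = 0) : e (Fin.last _) • y (Fin.last _) = 0 := by
  rw [← hy 0, sum_unitFractionVertex_smul, if_pos rfl]

theorem eq_zero_of_sum_unitFractionVertex_smul
    (hy : ∀ l, ∑ i, unitFractionVertex e i l • y i = 0) (hsum : ∑ i, y i = 0)
    (hlast : y (Fin.last _) = 0) : y = 0 := by
  have hne : ∀ l : Fin (n + 1), l ≠ 0 → y l.castSucc = 0 := fun l hl => by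
    simpa [sum_unitFractionVertex_smul, hl, hlast] using hy l
  have hzero : y (Fin.castSucc 0) = 0 := by
    rwa [Fin.sum_univ_castSucc, hlast, add_zero,
      Finset.sum_eq_single 0 (fun l _ => hne l) (by simp)] at hsum
  refine funext (Fin.lastCases hlast fun l => ?_)
  by_cases hl : l = 0
  · exact hl ▸ hzero
  · exact hne l hl

end Sum

theorem affineIndependent_unitFractionVertex (he : 0 < e (Fin.last _)) :
    AffineIndependent ℝ fun i => latticePoint (unitFractionVertex e i) := by
  rw [affineIndependent_iff_of_fintype]
  intro w hw hwp
  rw [Finset.univ.weightedVSub_eq_linear_combination hw] at hwp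
  have hy : ∀ l, ∑ i, unitFractionVertex e i l • w i = 0 := fun l => by
    simpa [latticePoint, mul_comm] using congrFun hwp l
  refine congrFun (eq_zero_of_sum_unitFractionVertex_smul hy hw ?_)
  exact (smul_eq_zero.1 (last_nsmul_eq_zero_of_sum_unitFractionVertex_smul hy)).resolve_left he.ne'

theorem div_nsmul_coe_one_div {a b : ℕ} (ha : 0 < a) (h : b ∣ a) :
    (a / b) • ((1 / (a : ℝ) : ℝ) : AddCircle (1 : ℝ)) =
      ((1 / (b : ℝ) : ℝ) : AddCircle (1 : ℝ)) := by
  obtain ⟨m, rfl⟩ := h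
  have hb : 0 < b := Nat.pos_of_mul_pos_right ha
  have hm : (m : ℝ) ≠ 0 := Nat.cast_ne_zero.2 (Nat.pos_of_mul_pos_left ha).ne'
  rw [Nat.mul_div_cancel_left m hb, ← AddCircle.coe_nsmul, nsmul_eq_mul, Nat.cast_mul]
  field_simp

theorem unitFractions_mem_simplexGroup (he : 0 < e (Fin.last _)) (hdvd : ∀ i, e i ∣ e (Fin.last _))
    (hsum : ∑ i, unitFractions e i = 0) :
    unitFractions e ∈ simplexGroup (unitFractionVertex e) := by
  refine ⟨fun l => ?_, hsum⟩
  rw [sum_unitFractionVertex_smul]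
  split_ifs
  · exact (nsmul_unitFractions_apply_eq_zero_iff he _).2 dvd_rfl
  · exact sub_eq_zero.2 (div_nsmul_coe_one_div he (hdvd _)).symm

theorem simplexGroup_unitFractionVertex (he : 0 < e (Fin.last _))
    (hdvd : ∀ i, e i ∣ e (Fin.last _)) (hsum : ∑ i, unitFractions e i = 0) :
    simplexGroup (unitFractionVertex e) = AddSubgroup.zmultiples (unitFractions e) := by
  have hmem := unitFractions_mem_simplexGroup he hdvd hsum
  refine le_antisymm (fun y hy => ?_) (AddSubgroup.zmultiples_le_of_mem hmem)
  obtain ⟨a, -, ha⟩ := (AddCircle.nsmul_eq_zero_iff he).1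
    (last_nsmul_eq_zero_of_sum_unitFractionVertex_smul hy.1)
  have hsub := sub_mem hy (nsmul_mem hmem a)
  refine AddSubgroup.mem_zmultiples_iff.2 ⟨a, ?_⟩
  rw [natCast_zsmul, eq_comm, ← sub_eq_zero]
  refine eq_zero_of_sum_unitFractionVertex_smul hsub.1 hsub.2 ?_
  rw [Pi.sub_apply, Pi.smul_apply, nsmul_unitFractions_apply, ← ha, mul_one, sub_self]

end UnitFractionVertex

/-! ### The classification -/

/-- The denominators `e` of the vectors `(1 / e 0, …, 1 / e d)` generating the group of a simplex
counted by `M(v, k)`. -/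
structure IsDenominatorVector (v k : ℕ) {d : ℕ} (e : Fin (d + 1) → ℕ) : Prop where
  mono : Monotone e
  tower : IsDivisorTower v (Finset.univ.image e)
  heights : HasArithmeticHeights (Finset.univ.image e) v (k + 1) (fiberCard e)

theorem isDivisorChainSimplex_iff {v k d : ℕ} {P : Set (Fin d → ℝ)} :
    IsDivisorChainSimplex v k P ↔ ∃ p e, IsVertexOrdering P p ∧ IsDenominatorVector v k e ∧
      simplexGroup p = AddSubgroup.zmultiples (unitFractions e) := by
  constructor
  · rintro ⟨-, ⟨p, ⟨hp, rfl⟩, x, hx, hgroup⟩, hδ⟩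
    obtain ⟨e, hmono, htower, rfl⟩ := exists_eq_unitFractions_of_isDivisorBlockVector hx
    exact ⟨p, e, ⟨hp, rfl⟩, ⟨hmono, htower,
      (isDeltaPolynomial_iff_hasArithmeticHeights hp htower hgroup).1 hδ⟩, hgroup⟩
  · rintro ⟨p, e, ⟨hp, rfl⟩, he, hgroup⟩
    have hpos := pos_of_isDivisorTower_image he.tower
    refine ⟨isGorenstein_of_denominators hp hpos ?_ (hgroup ▸ AddSubgroup.mem_zmultiples _),
      ⟨p, ⟨hp, rfl⟩, _, isDivisorBlockVector_unitFractions he.mono he.tower, hgroup⟩,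
      (isDeltaPolynomial_iff_hasArithmeticHeights hp he.tower hgroup).2 he.heights⟩
    exact fun x hx => nsmul_eq_zero_of_mem_zmultiples_unitFractions hpos (hgroup ▸ hx)

theorem IsDenominatorVector.exists_simplexGroup_eq {v k d : ℕ} {e : Fin (d + 1) → ℕ}
    (he : IsDenominatorVector v k e) : ∃ p : Fin (d + 1) → Fin d → ℤ,
      AffineIndependent ℝ (fun i => latticePoint (p i)) ∧
        simplexGroup p = AddSubgroup.zmultiples (unitFractions e) := by
  have hpos := pos_of_isDivisorTower_image he.tower
  have hmem : ∀ i, e i ∈ Finset.univ.image e := fun i =>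
    Finset.mem_image_of_mem e (Finset.mem_univ i)
  have hsum := sum_unitFractions_eq_zero he.tower he.heights
  obtain _ | n := d
  · have hone : e 0 ∣ 1 :=
      (nsmul_unitFractions_apply_eq_zero_iff (hpos 0) 1).1 (by simpa using hsum)
    exact absurd (Nat.dvd_one.1 hone) (he.tower.one_lt_of_mem (hmem 0)).ne'
  · exact ⟨unitFractionVertex e, affineIndependent_unitFractionVertex (hpos _),
      simplexGroup_unitFractionVertex (hpos _) (fun i =>
        he.tower.dvd_of_le (hmem i) (hmem _) (he.mono (Fin.le_last i))) hsum⟩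

theorem count_ofFn {n : ℕ} (e : Fin n → ℕ) (c : ℕ) : (List.ofFn e).count c = fiberCard e c := by
  rw [← Multiset.coe_count, ← Fin.univ_val_map, Multiset.count_map]
  simp only [fiberCard, Finset.card, Finset.filter_val, eq_comm]

theorem ofFn_eq_of_fiberCard_eq {m n : ℕ} {e : Fin m → ℕ} {e' : Fin n → ℕ} (he : Monotone e)
    (he' : Monotone e') (h : fiberCard e = fiberCard e') : List.ofFn e = List.ofFn e' := by
  refine List.Perm.eq_of_sortedLE he.sortedLE_ofFn he'.sortedLE_ofFn (List.perm_iff_count.2 ?_)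
  simp only [count_ofFn, h, implies_true]

theorem exists_monotone_fiberCard_eq {C : Finset ℕ} {μ : ℕ → ℕ} (hC : C.Nonempty)
    (hμ : ∀ c ∈ C, 0 < μ c) : ∃ (d : ℕ) (e : Fin (d + 1) → ℕ),
      Monotone e ∧ Finset.univ.image e = C ∧ ∀ c ∈ C, fiberCard e c = μ c := by
  let m : Multiset ℕ := ∑ a ∈ C, Multiset.replicate (μ a) a
  obtain ⟨n, e, he⟩ : ∃ (n : ℕ) (e : Fin n → ℕ), m.sort (· ≤ ·) = List.ofFn e :=
    ⟨_, _, (List.ofFn_get _).symm⟩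
  have hfiber : ∀ c, fiberCard e c = if c ∈ C then μ c else 0 := fun c => by
    rw [← count_ofFn, ← he, ← Multiset.coe_count, Multiset.sort_eq]
    simp [m, Multiset.count_sum', Multiset.count_replicate]
  have himage : Finset.univ.image e = C := by
    ext c
    rw [← fiberCard_pos_iff, hfiber]
    split_ifs with hc
    · exact iff_of_true (hμ c hc) hc
    · exact iff_of_false (lt_irrefl 0) hc
  obtain _ | d := n
  · simp [← himage] at hC
  · exact ⟨d, e, List.sortedLE_ofFn_iff.1 (he ▸ (m.pairwise_sort _).sortedLE), himage,
      fun c hc => by rw [hfiber, if_pos hc]⟩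

theorem exists_isDenominatorVector {v k : ℕ} {C : Finset ℕ} (hv : v ≠ 1)
    (hC : IsDivisorTower v C) : ∃ (d : ℕ) (e : Fin (d + 1) → ℕ),
      IsDenominatorVector v k e ∧ Finset.univ.image e = C := by
  obtain ⟨μ, hμ, hheights⟩ := exists_hasArithmeticHeights hC k.succ_pos
  obtain ⟨d, e, he, rfl, hfiber⟩ := exists_monotone_fiberCard_eq ⟨v, hC.top_mem hv⟩ hμ
  exact ⟨d, e, ⟨he, hC, hheights.congr fun c hc => (hfiber c hc).symm⟩, rfl⟩

theorem IsDenominatorVector.ofFn_eq {v k d d' : ℕ} {e : Fin (d + 1) → ℕ}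
    {e' : Fin (d' + 1) → ℕ} (he : IsDenominatorVector v k e) (he' : IsDenominatorVector v k e')
    (h : Finset.univ.image e = Finset.univ.image e') : List.ofFn e = List.ofFn e' := by
  refine ofFn_eq_of_fiberCard_eq he.mono he'.mono (funext fun c => ?_)
  by_cases hc : c ∈ Finset.univ.image e
  · have hheights' : HasArithmeticHeights (Finset.univ.image e) v (k + 1) (fiberCard e') := by
      rw [h]
      exact he'.heights
    exact he.heights.unique he.tower k.succ_pos (fun a ha => fiberCard_pos_iff.2 ha)
      (fun a ha => fiberCard_pos_iff.2 (h ▸ ha)) hheights' c hc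
  · rw [Nat.eq_zero_of_not_pos (mt fiberCard_pos_iff.1 hc),
      Nat.eq_zero_of_not_pos (mt fiberCard_pos_iff.1 (h ▸ hc))]

/-- `q` is the class of a simplex whose group is generated by a vector `(1 / e 0, …, 1 / e d)` as in
`IsDenominatorVector v k`, with set of denominators `C`. -/
def IsClassOfChain (v k : ℕ) (C : Finset ℕ) (q : Σ d : ℕ, Quotient (unimodularSetoid d)) : Prop :=
  ∃ (d : ℕ) (P : Set (Fin d → ℝ)) (p : Fin (d + 1) → Fin d → ℤ) (e : Fin (d + 1) → ℕ),
    q = ⟨d, Quotient.mk (unimodularSetoid d) P⟩ ∧ IsVertexOrdering P p ∧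
      IsDenominatorVector v k e ∧ simplexGroup p = AddSubgroup.zmultiples (unitFractions e) ∧
      Finset.univ.image e = C

theorem mem_divisorChainClasses_iff {v k : ℕ} {q : Σ d : ℕ, Quotient (unimodularSetoid d)} :
    q ∈ divisorChainClasses v k ↔ ∃ C, IsClassOfChain v k C q := by
  constructor
  · rintro ⟨d, P, hP, rfl⟩
    obtain ⟨p, e, hp, he, hgroup⟩ := isDivisorChainSimplex_iff.1 hP
    exact ⟨_, d, P, p, e, rfl, hp, he, hgroup, rfl⟩
  · rintro ⟨-, d, P, p, e, rfl, hp, he, hgroup, rfl⟩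
    exact ⟨d, P, isDivisorChainSimplex_iff.2 ⟨p, e, hp, he, hgroup⟩, rfl⟩

theorem exists_isClassOfChain {v k : ℕ} {C : Finset ℕ} (hv : v ≠ 1) (hC : IsDivisorTower v C) :
    ∃ q, IsClassOfChain v k C q := by
  obtain ⟨d, e, he, himage⟩ := exists_isDenominatorVector (k := k) hv hC
  obtain ⟨p, hp, hgroup⟩ := he.exists_simplexGroup_eq
  exact ⟨_, d, _, p, e, rfl, ⟨hp, rfl⟩, he, hgroup, himage⟩

theorem IsClassOfChain.tower {v k : ℕ} {C : Finset ℕ}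
    {q : Σ d : ℕ, Quotient (unimodularSetoid d)} (h : IsClassOfChain v k C q) :
    IsDivisorTower v C := by
  obtain ⟨_, _, _, _, -, -, he, -, rfl⟩ := h
  exact he.tower

theorem IsClassOfChain.class_unique {v k : ℕ} {C : Finset ℕ}
    {q q' : Σ d : ℕ, Quotient (unimodularSetoid d)} (h : IsClassOfChain v k C q)
    (h' : IsClassOfChain v k C q') : q = q' := by
  obtain ⟨d, -, p, e, rfl, ⟨hp, rfl⟩, he, hgroup, rfl⟩ := h
  obtain ⟨d', -, p', e', rfl, ⟨hp', rfl⟩, he', hgroup', himage⟩ := h'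
  have hlist := he.ofFn_eq he' himage.symm
  obtain rfl : d = d' := by simpa using congrArg List.length hlist
  obtain rfl := List.ofFn_injective hlist
  exact congrArg _ (Quotient.sound
    (unimodularlyEquivalent_of_simplexGroup_eq hp hp' (hgroup.trans hgroup'.symm)))

theorem IsClassOfChain.chain_unique {v k : ℕ} {C C' : Finset ℕ}
    {q : Σ d : ℕ, Quotient (unimodularSetoid d)} (h : IsClassOfChain v k C q)
    (h' : IsClassOfChain v k C' q) : C = C' := by
  obtain ⟨d, P, p, e, rfl, hp, he, hgroup, rfl⟩ := h
  obtain ⟨d', P', p', e', hq, hp', he', hgroup', rfl⟩ := h'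
  obtain ⟨rfl, hq⟩ := Sigma.mk.inj hq
  obtain ⟨σ, hσ⟩ := exists_perm_comp_mem_simplexGroup_iff hp hp' (Quotient.exact (eq_of_heq hq))
  have hcomp : e = e' ∘ σ := funext fun j => Nat.dvd_right_iff_eq.1 fun a => by
    rw [← forall_mem_zmultiples_unitFractions_nsmul_eq_zero_iff
      (pos_of_isDivisorTower_image he.tower), ← hgroup, Function.comp_apply,
      ← forall_mem_zmultiples_unitFractions_nsmul_eq_zero_iff
      (pos_of_isDivisorTower_image he'.tower), ← hgroup']
    refine ⟨fun h x hx => h _ ((hσ x).2 hx), fun h y hy => ?_⟩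
    simpa using h (y ∘ σ.symm) ((hσ _).1 (by simpa [Function.comp_assoc] using hy))
  rw [hcomp, ← Finset.image_image, Finset.image_univ_equiv]

theorem numDivisorChainSimplices_eq_ncard (v k : ℕ) :
    numDivisorChainSimplices v k = {C | IsDivisorTower v C}.ncard := by
  rw [numDivisorChainSimplices]
  split_ifs with hv
  · rw [hv, setOf_isDivisorTower_one, Set.ncard_singleton]
  · choose q hq using fun C (hC : IsDivisorTower v C) => exists_isClassOfChain (k := k) hv hC
    refine (Set.ncard_congr q (fun C hC => ?_) (fun C C' hC hC' h => ?_) fun x hx => ?_).symm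
    · exact mem_divisorChainClasses_iff.2 ⟨C, hq C hC⟩
    · exact (hq C hC).chain_unique (h ▸ hq C' hC')
    · obtain ⟨C, hC⟩ := mem_divisorChainClasses_iff.1 hx
      exact ⟨C, hC.tower, (hq C hC.tower).class_unique hC⟩

theorem corollary4p3 (v k : ℕ) (hv : 1 < v) :
    numDivisorChainSimplices v k = (divisorChains v).ncard ∧
      numDivisorChainSimplices v k =
        ∑ n ∈ v.divisors \ {v}, numDivisorChainSimplices n k := by
  have hproper : v.divisors \ {v} = v.properDivisors := by
    rw [Finset.sdiff_singleton_eq_erase, ← Nat.insert_self_properDivisors (by omega),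
      Finset.erase_insert Nat.self_notMem_properDivisors]
  simp_rw [numDivisorChainSimplices_eq_ncard, hproper]
  exact ⟨by rw [divisorChains_eq_setOf_isDivisorTower hv.ne'], ncard_isDivisorTower_eq_sum hv⟩
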